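/- Let $M$ be a complex manifold of complex dimension $n>1$ with complex structure $J$, and let $g$ be an indefinite Hermitian metric on $M$ of index $\nu$, $0<\nu<2n$, with Levi-Civita connection $\nabla$. Assume that $(M,J,g)$ is locally conformal Kähler with Lee form $\omega$: each point has an open neighbourhood $U$ and a smooth $f:U\to\mathbb R$ such that $e^{-f}g$ is an indefinite Kähler metric on $U$ (i.e. $J$ is parallel for its Levi-Civita connection) and $\omega=df$ on $U$. Assume that $\nabla\omega=0$. Let $B$ be the Lee field, $g(X,B)=\omega(X)$, let $A=-JB$ be the anti-Lee field, and let $\mathrm{Sing}(B)=\{x: B_x=0\}$. Then the function $g(B,B)$ is locally constant. Assume moreover that it is a constant $c\in\mathbb R$ (which is automatic if $M$ is connected). Put $M(c)=M\setminus\mathrm{Sing}(B)$, which is open in $M$. On $M(c)$ the sum $P_x=\mathbb RA_x\oplus\mathbb RB_x\subset T_xM$ is direct, $P$ is a smooth involutive distribution of rank $2$, and it is integrable: every point of $M(c)$ lies in the domain, contained in $M(c)$, of a smooth chart of $M$ in which $P$ becomes a fixed $2$-plane of the model space. Hence $P$ is tangent to a foliation $\mathcal F_c$ of $M(c)$ by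 real surfaces. Moreover, for every smoothly immersed surface $i:L\to M(c)$ with $di(T_pL)=P_{i(p)}$ for all $p\in L$, in particular for every leaf $L$ of $\mathcal F_c$: (i) if $c\neq 0$, then $\mathrm{Sing}(B)=\emptyset$, the metric $\mathrm{sign}(c)\,i^*g$ on $L$ is Riemannian, the second fundamental form of $L$ in $(M,g)$ (the normal part of $\nabla$) vanishes, and $L$ is totally geodesic: each geodesic of the induced connection of $L$ is a geodesic of $(M,g)$; (ii) if $c=0$ and $n\ge 3$, then $L$ is isotropic, i.e. $T(L)\cap T(L)^\perp$ has rank $\dim L$ and $\dim L<\operatorname{codim}L$; if $c=0$ and $n=2$, then $L$ is totally lightlike, i.e. $T(L)\cap T(L)^\perp$ has rank $\dim L=\operatorname{codim}L$; (iii) if $c=0$ and $n\ge 3$, let $S$ be any smooth complement of $T(L)$ in $T(L)^\perp$ and $\mathrm{ltr}$ any smooth totally null complement of $T(L)$ in $S^\perp$. Then the transversal vector bundle $\mathrm{tr}(T(L))=\mathrm{ltr}\oplus S$ is a complement of $T(L)$ in $i^*TM$, and the second fundamental form of $L$ with respect to it (the $\mathrm{tr}(T(L))$-component of $\nabla_XY$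 for $X,Y$ tangent to $L$) vanishes. -/

import Mathlib

open scoped Manifold ContDiff Topology

noncomputable section

namespace LCK

/-! ### Complex manifolds and their real tangent bundle

A complex `n`-manifold `M` is charted on a complex normed space `E` of complex dimension `n`, with
holomorphic transition maps.  Its real tangent bundle is the one of the model `𝓘(ℝ, E)`. -/

/-- A complex manifold is a real (analytic, hence smooth) manifold. -/
instance isManifold_real {E : Type*} [NormedAddCommGroup E] [NormedSpace ℂ E]
    {M : Type*} [TopologicalSpace M] [ChartedSpace E M] [IsManifold 𝓘(ℂ, E) ω M] :
    IsManifold 𝓘(ℝ, E) ω M := by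
  apply isManifold_of_contDiffOn
  intro e e' he he'
  have h := (contDiffGroupoid ω 𝓘(ℂ, E)).compatible he he'
  rw [contDiffGroupoid, mem_groupoid_of_pregroupoid] at h
  have h' := ContDiffOn.restrict_scalars ℝ h.1
  simpa using h'

section Definitions

variable {E : Type*} [NormedAddCommGroup E] [NormedSpace ℂ E]
  {M : Type*} [TopologicalSpace M] [ChartedSpace E M]

/-- The complex structure `J` on the real tangent space at `x`: multiplication by `i` in the
preferred holomorphic chart at `x` (hence in any holomorphic chart). -/
def complexStructure (x : M) : TangentSpace 𝓘(ℝ, E) x →L[ℝ] TangentSpace 𝓘(ℝ, E) x :=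
  (show E →L[ℝ] E from (Complex.I • ContinuousLinearMap.id ℂ E).restrictScalars ℝ)

/-- A field of bilinear forms `h` on the tangent spaces, as bilinear forms in the algebraic
sense. -/
def form (h : Π x : M, TangentSpace 𝓘(ℝ, E) x →L[ℝ] TangentSpace 𝓘(ℝ, E) x →L[ℝ] ℝ) (x : M) :
    LinearMap.BilinForm ℝ (TangentSpace 𝓘(ℝ, E) x) :=
  LinearMap.mk₂ ℝ (fun v w => h x v w) (by intros; simp) (by intros; simp) (by intros; simp)
    (by intros; simp)

/-- The orthogonal complement of a subspace of a tangent space. -/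
def perp (h : Π x : M, TangentSpace 𝓘(ℝ, E) x →L[ℝ] TangentSpace 𝓘(ℝ, E) x →L[ℝ] ℝ) (x : M)
    (W : Submodule ℝ (TangentSpace 𝓘(ℝ, E) x)) : Submodule ℝ (TangentSpace 𝓘(ℝ, E) x) :=
  (form h x).orthogonal W

/-- `g` is an indefinite Hermitian metric of index `ν`: a smooth field of symmetric nondegenerate
bilinear forms of index `ν` (the maximal dimension of a negative definite subspace), for which the
complex structure is isometric. -/
structure IsHermitianMetric [IsManifold 𝓘(ℂ, E) ω M]
    (g : Π x : M, TangentSpace 𝓘(ℝ, E) x →L[ℝ] TangentSpace 𝓘(ℝ, E) x →L[ℝ] ℝ) (ν : ℕ) :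
    Prop where
  contMDiff : ContMDiff 𝓘(ℝ, E) (𝓘(ℝ, E).prod 𝓘(ℝ, E →L[ℝ] E →L[ℝ] ℝ)) ∞
    (fun x => Bundle.TotalSpace.mk' (E →L[ℝ] E →L[ℝ] ℝ)
      (E := fun x : M => TangentSpace 𝓘(ℝ, E) x →L[ℝ] TangentSpace 𝓘(ℝ, E) x →L[ℝ] ℝ) x (g x))
  symm : ∀ (x : M) (v w : TangentSpace 𝓘(ℝ, E) x), g x v w = g x w v
  nondegenerate : ∀ (x : M) (v : TangentSpace 𝓘(ℝ, E) x), (∀ w, g x v w = 0) → v = 0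
  index : ∀ x : M, sigNeg (form g x).toQuadraticMap = ν
  hermitian : ∀ (x : M) (v w : TangentSpace 𝓘(ℝ, E) x),
    g x (complexStructure x v) (complexStructure x w) = g x v w

/-- The vector field `X` is differentiable at `x`. -/
abbrev IsDiffAt [IsManifold 𝓘(ℂ, E) ω M] (X : Π x : M, TangentSpace 𝓘(ℝ, E) x) (x : M) : Prop :=
  MDifferentiableAt 𝓘(ℝ, E) 𝓘(ℝ, E).tangent (fun y => (⟨y, X y⟩ : TangentBundle 𝓘(ℝ, E) M)) x

/-- `nabla` is the Levi-Civita connection of the metric `h` on the open set `U`: a covariant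
derivative on `U` which is torsion free and for which `h` is parallel.
Here `nabla Y x v` is `∇_v Y` at `x`. -/
structure IsLeviCivitaOn
    (h : Π x : M, TangentSpace 𝓘(ℝ, E) x →L[ℝ] TangentSpace 𝓘(ℝ, E) x →L[ℝ] ℝ)
    (nabla : (Π x : M, TangentSpace 𝓘(ℝ, E) x) →
      (Π x : M, TangentSpace 𝓘(ℝ, E) x →L[ℝ] TangentSpace 𝓘(ℝ, E) x))
    (U : Set M) [IsManifold 𝓘(ℂ, E) ω M] : Prop where
  isCovariantDerivativeOn : IsCovariantDerivativeOn E nabla U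
  torsionFree : ∀ x ∈ U, ∀ X Y : Π x : M, TangentSpace 𝓘(ℝ, E) x,
    IsDiffAt X x → IsDiffAt Y x →
      nabla Y x (X x) - nabla X x (Y x) = VectorField.mlieBracket 𝓘(ℝ, E) X Y x
  metric : ∀ x ∈ U, ∀ X Y : Π x : M, TangentSpace 𝓘(ℝ, E) x,
    IsDiffAt X x → IsDiffAt Y x → ∀ v : TangentSpace 𝓘(ℝ, E) x,
      mvfderiv 𝓘(ℝ, E) (fun y => h y (X y) (Y y)) x v
        = h x (nabla X x v) (Y x) + h x (X x) (nabla Y x v)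

/-- The metric `h` is an indefinite Kähler metric on the open set `U`: the complex structure is
parallel, `∇J = 0`, for the Levi-Civita connection of `h` on `U`. -/
def IsKahlerOn (h : Π x : M, TangentSpace 𝓘(ℝ, E) x →L[ℝ] TangentSpace 𝓘(ℝ, E) x →L[ℝ] ℝ)
    (U : Set M) [IsManifold 𝓘(ℂ, E) ω M] : Prop :=
  ∃ nabla : (Π x : M, TangentSpace 𝓘(ℝ, E) x) →
      (Π x : M, TangentSpace 𝓘(ℝ, E) x →L[ℝ] TangentSpace 𝓘(ℝ, E) x),
    IsLeviCivitaOn h nabla U ∧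
    ∀ x ∈ U, ∀ Y : Π x : M, TangentSpace 𝓘(ℝ, E) x, IsDiffAt Y x →
      ∀ v : TangentSpace 𝓘(ℝ, E) x,
        nabla (fun y => complexStructure y (Y y)) x v = complexStructure x (nabla Y x v)

/-- `g` is locally conformal Kähler with Lee form `lee`: each point has an open neighbourhood `U`
carrying a smooth function `f` such that `e^{-f} g` is an indefinite Kähler metric on `U` and
`lee = df` on `U`. -/
def IsLocallyConformalKahler [IsManifold 𝓘(ℂ, E) ω M]
    (g : Π x : M, TangentSpace 𝓘(ℝ, E) x →L[ℝ] TangentSpace 𝓘(ℝ, E) x →L[ℝ] ℝ)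
    (lee : Π x : M, TangentSpace 𝓘(ℝ, E) x →L[ℝ] ℝ) : Prop :=
  ∀ x : M, ∃ (U : Set M) (f : M → ℝ), IsOpen U ∧ x ∈ U ∧
    ContMDiffOn 𝓘(ℝ, E) 𝓘(ℝ, ℝ) ∞ f U ∧
    IsKahlerOn (fun y => Real.exp (-f y) • g y) U ∧
    ∀ y ∈ U, lee y = mvfderiv 𝓘(ℝ, E) f y

/-- The 1-form `lee` is parallel: `∇ω = 0`. -/
def IsParallelForm
    (nabla : (Π x : M, TangentSpace 𝓘(ℝ, E) x) →
      (Π x : M, TangentSpace 𝓘(ℝ, E) x →L[ℝ] TangentSpace 𝓘(ℝ, E) x))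
    (lee : Π x : M, TangentSpace 𝓘(ℝ, E) x →L[ℝ] ℝ) [IsManifold 𝓘(ℂ, E) ω M] : Prop :=
  ∀ (x : M) (Y : Π x : M, TangentSpace 𝓘(ℝ, E) x), IsDiffAt Y x →
    ∀ v : TangentSpace 𝓘(ℝ, E) x,
      mvfderiv 𝓘(ℝ, E) (fun y => lee y (Y y)) x v = lee x (nabla Y x v)

/-- `B` is the Lee field: `g(X, B) = ω(X)`. -/
def IsLeeField (g : Π x : M, TangentSpace 𝓘(ℝ, E) x →L[ℝ] TangentSpace 𝓘(ℝ, E) x →L[ℝ] ℝ)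
    (lee : Π x : M, TangentSpace 𝓘(ℝ, E) x →L[ℝ] ℝ)
    (B : Π x : M, TangentSpace 𝓘(ℝ, E) x) : Prop :=
  ∀ (x : M) (v : TangentSpace 𝓘(ℝ, E) x), g x v (B x) = lee x v

/-- The anti-Lee field `A = -JB`. -/
def antiLee (B : Π x : M, TangentSpace 𝓘(ℝ, E) x) : Π x : M, TangentSpace 𝓘(ℝ, E) x :=
  fun x => -complexStructure x (B x)

/-- `Sing(B)`, the zero set of `B`. -/
def Sing (B : Π x : M, TangentSpace 𝓘(ℝ, E) x) : Set M := {x | B x = 0}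

/-- `P = ℝA + ℝB`. -/
def leePlane (B : Π x : M, TangentSpace 𝓘(ℝ, E) x) (x : M) :
    Submodule ℝ (TangentSpace 𝓘(ℝ, E) x) :=
  Submodule.span ℝ {antiLee B x, B x}

/-! ### Distributions and foliations -/

/-- `P` is a smooth distribution of rank `k` on the open set `U`: locally on `U` it is spanned by
`k` smooth, pointwise linearly independent vector fields. -/
def IsSmoothDistributionOn [IsManifold 𝓘(ℂ, E) ω M]
    (P : Π x : M, Submodule ℝ (TangentSpace 𝓘(ℝ, E) x)) (k : ℕ) (U : Set M) : Prop :=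
  ∀ x ∈ U, ∃ V ∈ 𝓝 x, ∃ s : Fin k → Π y : M, TangentSpace 𝓘(ℝ, E) y,
    (∀ j, ContMDiffOn 𝓘(ℝ, E) 𝓘(ℝ, E).tangent ∞
      (fun y => (⟨y, s j y⟩ : TangentBundle 𝓘(ℝ, E) M)) V) ∧
    ∀ y ∈ V, LinearIndependent ℝ (fun j => s j y) ∧
      P y = Submodule.span ℝ (Set.range fun j => s j y)

/-- `P` is involutive on `U`: Lie brackets of smooth local sections of `P` are sections of `P`. -/
def IsInvolutiveOn [IsManifold 𝓘(ℂ, E) ω M]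
    (P : Π x : M, Submodule ℝ (TangentSpace 𝓘(ℝ, E) x)) (U : Set M) : Prop :=
  ∀ V : Set M, IsOpen V → V ⊆ U → ∀ X Y : Π x : M, TangentSpace 𝓘(ℝ, E) x,
    ContMDiffOn 𝓘(ℝ, E) 𝓘(ℝ, E).tangent ∞ (fun y => (⟨y, X y⟩ : TangentBundle 𝓘(ℝ, E) M)) V →
    ContMDiffOn 𝓘(ℝ, E) 𝓘(ℝ, E).tangent ∞ (fun y => (⟨y, Y y⟩ : TangentBundle 𝓘(ℝ, E) M)) V →
    (∀ y ∈ V, X y ∈ P y ∧ Y y ∈ P y) →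
    ∀ y ∈ V, VectorField.mlieBracket 𝓘(ℝ, E) X Y y ∈ P y

/-- `P` is the tangent distribution of a smooth foliation of the open set `U` by leaves of
dimension `k`: `U` is covered by smooth charts `φ` of `M` (foliated charts) in which `P` becomes a
fixed `k`-dimensional subspace `F` of the model space, so that the plaques are the sets
`φ⁻¹(a + F)`. -/
def IsTangentToFoliationOn [IsManifold 𝓘(ℂ, E) ω M]
    (P : Π x : M, Submodule ℝ (TangentSpace 𝓘(ℝ, E) x)) (k : ℕ) (U : Set M) : Prop :=
  ∀ x ∈ U, ∃ φ ∈ IsManifold.maximalAtlas 𝓘(ℝ, E) ∞ M, x ∈ φ.source ∧ φ.source ⊆ U ∧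
    ∃ F : Submodule ℝ E, Module.finrank ℝ F = k ∧
      ∀ y ∈ φ.source, ∀ v : TangentSpace 𝓘(ℝ, E) y,
        v ∈ P y ↔ (mfderiv 𝓘(ℝ, E) 𝓘(ℝ, E) φ y v : E) ∈ F

/-! ### Integral surfaces and their second fundamental form -/

section Surfaces

variable {L : Type*} [TopologicalSpace L] [ChartedSpace (EuclideanSpace ℝ (Fin 2)) L]

/-- The tangent plane `di(T_p L)` of a surface `i : L → M`, as a subspace of `T_{i(p)} M`. -/
def tangentPlane (i : L → M) (p : L) : Submodule ℝ (TangentSpace 𝓘(ℝ, E) (i p)) :=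
  LinearMap.range
    (mfderiv 𝓘(ℝ, EuclideanSpace ℝ (Fin 2)) 𝓘(ℝ, E) i p).toLinearMap

/-- `i : L → M` is an integral surface of `P` in `U`: a smooth immersion into `U` of a surface
with `di(T_p L) = P_{i(p)}` for all `p`.  The leaves of the foliation tangent to `P` are the maximal
connected, injectively immersed, integral surfaces. -/
structure IsIntegralSurface [IsManifold 𝓘(ℂ, E) ω M]
    (P : Π x : M, Submodule ℝ (TangentSpace 𝓘(ℝ, E) x)) (U : Set M) (i : L → M) : Prop where
  contMDiff : ContMDiff 𝓘(ℝ, EuclideanSpace ℝ (Fin 2)) 𝓘(ℝ, E) ∞ i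
  mem : ∀ p, i p ∈ U
  immersion : ∀ p,
    Function.Injective (mfderiv 𝓘(ℝ, EuclideanSpace ℝ (Fin 2)) 𝓘(ℝ, E) i p)
  tangent : ∀ p, tangentPlane i p = P (i p)

/-- A field `S` of subspaces of the tangent spaces of `M` along `i : L → M` is a smooth subbundle
of `i^* TM` of rank `k`. -/
def IsSubbundleAlong [IsManifold 𝓘(ℂ, E) ω M] (i : L → M)
    (S : Π p : L, Submodule ℝ (TangentSpace 𝓘(ℝ, E) (i p))) (k : ℕ) : Prop :=
  ∀ p : L, ∃ V ∈ 𝓝 p, ∃ s : Fin k → Π q : L, TangentSpace 𝓘(ℝ, E) (i q),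
    (∀ j, ContMDiffOn 𝓘(ℝ, EuclideanSpace ℝ (Fin 2)) 𝓘(ℝ, E).tangent ∞
      (fun q => (⟨i q, s j q⟩ : TangentBundle 𝓘(ℝ, E) M)) V) ∧
    ∀ q ∈ V, LinearIndependent ℝ (fun j => s j q) ∧
      S q = Submodule.span ℝ (Set.range fun j => s j q)

/-- The normal bundle `T(L)^⊥` along `i : L → M`. -/
def normalBundle (g : Π x : M, TangentSpace 𝓘(ℝ, E) x →L[ℝ] TangentSpace 𝓘(ℝ, E) x →L[ℝ] ℝ)
    (i : L → M) (p : L) : Submodule ℝ (TangentSpace 𝓘(ℝ, E) (i p)) :=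
  perp g (i p) (tangentPlane i p)

/-- The second fundamental form of `i : L → M` with respect to the complement `tr` of the tangent
bundle of `L` in `i^* TM` is defined and vanishes: `i^* TM = T(L) ⊕ tr`, and the `tr`-component
`h(v, Y)` of `∇_{di(v)} Y` is zero for each `v ∈ T_p L` and each smooth local vector field `Y`
tangent to `L`. -/
def SecondFundamentalFormVanishes [IsManifold 𝓘(ℂ, E) ω M]
    (nabla : (Π x : M, TangentSpace 𝓘(ℝ, E) x) →
      (Π x : M, TangentSpace 𝓘(ℝ, E) x →L[ℝ] TangentSpace 𝓘(ℝ, E) x))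
    (i : L → M) (tr : Π p : L, Submodule ℝ (TangentSpace 𝓘(ℝ, E) (i p))) : Prop :=
  ∀ p : L, ∃ hp : IsCompl (tr p) (tangentPlane i p),
    ∀ (v : TangentSpace 𝓘(ℝ, EuclideanSpace ℝ (Fin 2)) p)
      (Y : Π x : M, TangentSpace 𝓘(ℝ, E) x),
      ContMDiffAt 𝓘(ℝ, E) 𝓘(ℝ, E).tangent ∞
        (fun y => (⟨y, Y y⟩ : TangentBundle 𝓘(ℝ, E) M)) (i p) →
      (∀ᶠ q in 𝓝 p, Y (i q) ∈ tangentPlane i q) →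
      (tr p).projection (tangentPlane i p) hp
        (nabla Y (i p) (mfderiv 𝓘(ℝ, EuclideanSpace ℝ (Fin 2)) 𝓘(ℝ, E) i p v)) = 0

/-- `ε i^* g` is a Riemannian metric on `L`. -/
def IsRiemannianUpTo (g : Π x : M, TangentSpace 𝓘(ℝ, E) x →L[ℝ] TangentSpace 𝓘(ℝ, E) x →L[ℝ] ℝ)
    (i : L → M) (ε : ℝ) : Prop :=
  ∀ (p : L) (v : TangentSpace 𝓘(ℝ, EuclideanSpace ℝ (Fin 2)) p), v ≠ 0 →
    0 < ε * g (i p) (mfderiv 𝓘(ℝ, EuclideanSpace ℝ (Fin 2)) 𝓘(ℝ, E) i p v)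
      (mfderiv 𝓘(ℝ, EuclideanSpace ℝ (Fin 2)) 𝓘(ℝ, E) i p v)

/-- The velocity of a curve. -/
def velocity (γ : ℝ → M) (t : ℝ) : TangentSpace 𝓘(ℝ, E) (γ t) :=
  mfderiv 𝓘(ℝ, ℝ) 𝓘(ℝ, E) γ t (1 : ℝ)

/-- The covariant acceleration `∇_{γ'} γ'` of `γ` at the time `t` is `a`, computed from a smooth
local vector field extending the velocity of `γ` near `t`. Such an extension exists when
`γ'(t) ≠ 0` and when `γ` is constant near `t`; since a geodesic with `γ'(t) = 0` is constant, this
suffices for geodesics. -/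
def HasAcceleration [IsManifold 𝓘(ℂ, E) ω M]
    (nabla : (Π x : M, TangentSpace 𝓘(ℝ, E) x) →
      (Π x : M, TangentSpace 𝓘(ℝ, E) x →L[ℝ] TangentSpace 𝓘(ℝ, E) x))
    (γ : ℝ → M) (t : ℝ) (a : TangentSpace 𝓘(ℝ, E) (γ t)) : Prop :=
  ∃ V : Π x : M, TangentSpace 𝓘(ℝ, E) x,
    ContMDiffAt 𝓘(ℝ, E) 𝓘(ℝ, E).tangent ∞
      (fun y => (⟨y, V y⟩ : TangentBundle 𝓘(ℝ, E) M)) (γ t) ∧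
    (∀ᶠ s in 𝓝 t, V (γ s) = velocity γ s) ∧
    nabla V (γ t) (velocity γ t) = a

/-- The surface `i : L → M`, on which `g` is nondegenerate, is totally geodesic: each geodesic of
the induced connection of `L` (the tangential part of `∇`, so a curve with normal acceleration) is a
geodesic of `(M, g)`. -/
def IsTotallyGeodesic [IsManifold 𝓘(ℂ, E) ω M]
    (g : Π x : M, TangentSpace 𝓘(ℝ, E) x →L[ℝ] TangentSpace 𝓘(ℝ, E) x →L[ℝ] ℝ)
    (nabla : (Π x : M, TangentSpace 𝓘(ℝ, E) x) →
      (Π x : M, TangentSpace 𝓘(ℝ, E) x →L[ℝ] TangentSpace 𝓘(ℝ, E) x))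
    (i : L → M) : Prop :=
  ∀ (T : Set ℝ) (γ : ℝ → L), IsOpen T →
    ContMDiffOn 𝓘(ℝ, ℝ) 𝓘(ℝ, EuclideanSpace ℝ (Fin 2)) ∞ γ T →
    (∀ t ∈ T, ∃ a ∈ normalBundle g i (γ t), HasAcceleration nabla (fun s => i (γ s)) t a) →
    ∀ t ∈ T, HasAcceleration nabla (fun s => i (γ s)) t 0

/-- The radical `Rad T_p L = T_p L ∩ T_p L^⊥`. -/
def radical (g : Π x : M, TangentSpace 𝓘(ℝ, E) x →L[ℝ] TangentSpace 𝓘(ℝ, E) x →L[ℝ] ℝ)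
    (i : L → M) (p : L) : Submodule ℝ (TangentSpace 𝓘(ℝ, E) (i p)) :=
  tangentPlane i p ⊓ normalBundle g i p

/-- `L` is isotropic: the radical of its tangent bundle has rank `dim L`, and
`dim L < codim L`. -/
def IsIsotropic (g : Π x : M, TangentSpace 𝓘(ℝ, E) x →L[ℝ] TangentSpace 𝓘(ℝ, E) x →L[ℝ] ℝ)
    (i : L → M) : Prop :=
  ∀ p : L, Module.finrank ℝ (radical g i p) = Module.finrank ℝ (tangentPlane (E := E) i p) ∧
    Module.finrank ℝ (tangentPlane (E := E) i p) <
      Module.finrank ℝ (TangentSpace 𝓘(ℝ, E) (i p) ⧸ tangentPlane i p)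

/-- `L` is totally lightlike: the radical of its tangent bundle has rank
`dim L = codim L`. -/
def IsTotallyLightlike
    (g : Π x : M, TangentSpace 𝓘(ℝ, E) x →L[ℝ] TangentSpace 𝓘(ℝ, E) x →L[ℝ] ℝ)
    (i : L → M) : Prop :=
  ∀ p : L, Module.finrank ℝ (radical g i p) = Module.finrank ℝ (tangentPlane (E := E) i p) ∧
    Module.finrank ℝ (tangentPlane (E := E) i p) =
      Module.finrank ℝ (TangentSpace 𝓘(ℝ, E) (i p) ⧸ tangentPlane i p)

/-- `tr` is a transversal vector bundle of the isotropic surface `i : L → M` (`n = dim_ℂ M`):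
`tr = ltr ⊕ S` where the screen transversal bundle `S` is a smooth complement of `T(L)` in
`T(L)^⊥`, and the lightlike transversal bundle `ltr` is a smooth totally null complement of `T(L)`
in `S^⊥`. -/
def IsTransversalBundle [IsManifold 𝓘(ℂ, E) ω M]
    (g : Π x : M, TangentSpace 𝓘(ℝ, E) x →L[ℝ] TangentSpace 𝓘(ℝ, E) x →L[ℝ] ℝ) (n : ℕ)
    (i : L → M) (tr : Π p : L, Submodule ℝ (TangentSpace 𝓘(ℝ, E) (i p))) : Prop :=
  ∃ S ltr : Π p : L, Submodule ℝ (TangentSpace 𝓘(ℝ, E) (i p)),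
    IsSubbundleAlong i S (2 * n - 4) ∧ IsSubbundleAlong i ltr 2 ∧
    ∀ p : L,
      Disjoint (tangentPlane i p) (S p) ∧ tangentPlane i p ⊔ S p = normalBundle g i p ∧
      Disjoint (tangentPlane i p) (ltr p) ∧ tangentPlane i p ⊔ ltr p = perp g (i p) (S p) ∧
      (∀ v ∈ ltr p, ∀ w ∈ ltr p, g (i p) v w = 0) ∧
      tr p = ltr p ⊔ S p

end Surfaces

end Definitions

end LCK

end

/-!
On the set where `e^{-f} g` is Kähler with `ω = df`, the Levi-Civita connection of `e^{-f} g` is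
`D_X Y = ∇_X Y - (ω(X) Y + ω(Y) X - g(X, Y) B) / 2`, the Weyl connection, which does not depend on
`f`. Hence `D J = 0` everywhere, and with `∇ B = 0` this gives `∇_X A = 0` for `X` in `P`. So `∇`
preserves sections of `P` along maps tangent to `P`: this one fact makes `P` involutive, makes the
second fundamental form of an integral surface vanish for every complement of its tangent bundle,
and puts the acceleration of its curves in `P`. Since `A = -J B`, the metric on `P` is `g(B, B)`
times a Euclidean one, so `P` is definite or totally null.

The equation `D J = 0` also gives `L_B J = 0`, so that `B` is a holomorphic vector field. Where `B`
does not vanish, its holomorphic flow straightens it in a holomorphic chart. There `P` is the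
complex line of a constant vector, so no Frobenius theorem is needed.
-/

noncomputable section

namespace LCK

universe u

/-! ### Composition operators on spaces of continuous maps -/

section Calculus

variable {𝕜 : Type*} [RCLike 𝕜]

/-- Unlike `ContDiffAt.to_localInverse`, this gives one neighbourhood on which the inverse has all
derivatives. -/
theorem exists_openPartialHomeomorph_contDiffOn_symm
    {E F : Type*} [NormedAddCommGroup E] [NormedSpace 𝕜 E] [CompleteSpace E]
    [NormedAddCommGroup F] [NormedSpace 𝕜 F]
    {f : E → F} {U : Set E} (hU : IsOpen U) (hf : ContDiffOn 𝕜 ∞ f U) {a : E} (ha : a ∈ U)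
    {f' : E ≃L[𝕜] F} (hf' : HasFDerivAt f (f' : E →L[𝕜] F) a) :
    ∃ e : OpenPartialHomeomorph E F, e = f ∧ a ∈ e.source ∧ e.source ⊆ U ∧
      ContDiffOn 𝕜 ∞ e.symm e.target := by
  have hf_at : ∀ x ∈ U, ContDiffAt 𝕜 ∞ f x := fun x hx => hf.contDiffAt (hU.mem_nhds hx)
  let e₀ := (hf_at a ha).toOpenPartialHomeomorph f hf' (by simp)
  let V : Set E := U ∩ fderiv 𝕜 f ⁻¹' Set.range ((↑) : (E ≃L[𝕜] F) → E →L[𝕜] F)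
  have hV : IsOpen V :=
    (hf.continuousOn_fderiv_of_isOpen hU (by simp)).isOpen_inter_preimage hU
      ContinuousLinearEquiv.isOpen
  have haV : a ∈ V := ⟨ha, f', hf'.fderiv.symm⟩
  let e := e₀.restrOpen V hV
  refine ⟨e, rfl, ⟨(hf_at a ha).mem_toOpenPartialHomeomorph_source hf' (by simp), haV⟩,
    fun x hx => hx.2.1, fun y hy => ?_⟩
  obtain ⟨-, hyU, g', hg'⟩ := e.map_target hy
  have hderiv : HasFDerivAt e (g' : E →L[𝕜] F) (e.symm y) :=
    hg' ▸ ((hf_at _ hyU).differentiableAt (by simp)).hasFDerivAt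
  exact (e.contDiffAt_symm hy hderiv (hf_at _ hyU)).contDiffWithinAt

theorem fderiv_symm_fderiv {E F : Type*} [NormedAddCommGroup E] [NormedSpace 𝕜 E]
    [NormedAddCommGroup F] [NormedSpace 𝕜 F] {e : OpenPartialHomeomorph E F} {x : E}
    (hx : x ∈ e.source) (he : DifferentiableAt 𝕜 e x) (he' : DifferentiableAt 𝕜 e.symm (e x))
    (v : E) : fderiv 𝕜 e.symm (e x) (fderiv 𝕜 e x v) = v := by
  have hcomp : HasFDerivAt (e.symm ∘ e) ((fderiv 𝕜 e.symm (e x)).comp (fderiv 𝕜 e x)) x :=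
    he'.hasFDerivAt.comp x he.hasFDerivAt
  have hid : e.symm ∘ e =ᶠ[𝓝 x] id := e.eventually_left_inverse hx
  exact DFunLike.congr_fun (hcomp.unique ((hasFDerivAt_id x).congr_of_eventuallyEq hid)) v

theorem fderiv_prodMk_of_eventually_eq {P E : Type*} [NormedAddCommGroup P] [NormedSpace 𝕜 P]
    [NormedAddCommGroup E] [NormedSpace 𝕜 E] {Φ : P × E → E} {p₀ : P} {x₀ : E}
    (hΦ : DifferentiableAt 𝕜 Φ (p₀, x₀)) (hΦ_eq : ∀ᶠ x in 𝓝 x₀, Φ (p₀, x) = x) (w : E) :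
    fderiv 𝕜 Φ (p₀, x₀) (0, w) = w :=
  DFunLike.congr_fun ((hΦ.hasFDerivAt.comp x₀ (hasFDerivAt_prodMk_right p₀ x₀)).unique
    ((hasFDerivAt_id x₀).congr_of_eventuallyEq hΦ_eq)) w

/-- Apply the inverse function theorem to `(p, z) ↦ (p, G (p, z))`. -/
theorem exists_contDiffOn_implicit {P Z Z' : Type*} [NormedAddCommGroup P] [NormedSpace 𝕜 P]
    [CompleteSpace P] [NormedAddCommGroup Z] [NormedSpace 𝕜 Z] [CompleteSpace Z]
    [NormedAddCommGroup Z'] [NormedSpace 𝕜 Z'] {G : P × Z → Z'} {Ω : Set (P × Z)} (hΩ : IsOpen Ω)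
    (hG : ContDiffOn 𝕜 ∞ G Ω) {a : P × Z} (ha : a ∈ Ω) (hGa : G a = 0) {T : Z ≃L[𝕜] Z'}
    (hT : ∀ η, fderiv 𝕜 G a (0, η) = T η) :
    ∃ (ψ : P → Z) (W : Set P), IsOpen W ∧ a.1 ∈ W ∧ ContDiffOn 𝕜 ∞ ψ W ∧ ∀ p ∈ W,
      (p, ψ p) ∈ Ω ∧ G (p, ψ p) = 0 ∧
        ∀ v η, fderiv 𝕜 G (p, ψ p) (v, η) = 0 → fderiv 𝕜 ψ p v = η := by
  let H : P × Z → P × Z' := fun q => (q.1, G q)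
  have hGd : ∀ q ∈ Ω, DifferentiableAt 𝕜 G q := fun q hq =>
    (hG.contDiffAt (hΩ.mem_nhds hq)).differentiableAt (by simp)
  have hHd : ∀ q ∈ Ω, HasFDerivAt H ((ContinuousLinearMap.fst 𝕜 P Z).prod (fderiv 𝕜 G q)) q :=
    fun q hq => hasFDerivAt_fst.prodMk (hGd q hq).hasFDerivAt
  let H' : (P × Z) ≃L[𝕜] P × Z' := (ContinuousLinearEquiv.refl 𝕜 P).skewProd T
    ((fderiv 𝕜 G a).comp (ContinuousLinearMap.inl 𝕜 P Z))
  have hH' : HasFDerivAt H (H' : P × Z →L[𝕜] P × Z') a := by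
    refine (hHd a ha).congr_fderiv (ContinuousLinearMap.ext fun w => Prod.ext rfl ?_)
    change fderiv 𝕜 G a w = T w.2 + fderiv 𝕜 G a (w.1, 0)
    rw [← hT, ← map_add, Prod.mk_add_mk, zero_add, add_zero]
  obtain ⟨e, he, hae, heΩ, hesymm⟩ := exists_openPartialHomeomorph_contDiffOn_symm (f := H) hΩ
    (contDiffOn_fst.prodMk hG) ha hH'
  have hea : e a = (a.1, 0) := by rw [he, ← hGa]
  refine ⟨fun p => (e.symm (p, 0)).2, {p | (p, (0 : Z')) ∈ e.target},
    e.open_target.preimage (by fun_prop), (hea ▸ e.map_source hae :),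
    contDiff_snd.comp_contDiffOn (hesymm.comp (by fun_prop) fun p hp => hp), fun p hp => ?_⟩
  obtain ⟨hq, hHq⟩ : e.symm (p, 0) ∈ e.source ∧ H (e.symm (p, 0)) = (p, 0) :=
    ⟨e.map_target hp, he ▸ e.right_inv hp⟩
  have hsymm_diff : DifferentiableAt 𝕜 e.symm (p, 0) :=
    (hesymm.contDiffAt (e.open_target.mem_nhds hp)).differentiableAt (by simp)
  have hψ : HasFDerivAt (fun p => (e.symm (p, 0)).2)
      ((ContinuousLinearMap.snd 𝕜 P Z).comp ((fderiv 𝕜 e.symm (p, 0)).comp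
        (ContinuousLinearMap.inl 𝕜 P Z'))) p :=
    (hsymm_diff.hasFDerivAt.comp p (hasFDerivAt_prodMk_left p (0 : Z'))).snd
  have hgraph : (p, (e.symm (p, 0)).2) = e.symm (p, 0) := Prod.ext (congrArg Prod.fst hHq).symm rfl
  simp only [hgraph, hψ.fderiv]
  refine ⟨heΩ hq, congrArg Prod.snd hHq, fun v η hη => ?_⟩
  have hHd_q := hHd _ (heΩ hq)
  have hinv := fderiv_symm_fderiv hq (he ▸ hHd_q.differentiableAt)
    ((e.right_inv hp).symm ▸ hsymm_diff) (v, η)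
  rw [e.right_inv hp, he, hHd_q.fderiv, ContinuousLinearMap.prod_apply, hη] at hinv
  exact congrArg Prod.snd hinv

variable {K : Type*} [TopologicalSpace K]

open Classical in
/-- The composition operator `γ ↦ F ∘ γ` on continuous maps, extended by zero to those `γ` for
which `F ∘ γ` is not continuous. -/
def compOp {E G : Type*} [TopologicalSpace E] [TopologicalSpace G] [Zero G] (F : E → G)
    (γ : C(K, E)) : C(K, G) :=
  if h : Continuous (F ∘ γ) then ⟨F ∘ γ, h⟩ else 0

theorem compOp_apply {E G : Type*} [TopologicalSpace E] [TopologicalSpace G] [Zero G]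
    {F : E → G} {U : Set E} (hF : ContinuousOn F U) {γ : C(K, E)} (hγ : ∀ k, γ k ∈ U) (k : K) :
    compOp F γ k = F (γ k) := by
  have h : Continuous (F ∘ γ) := hF.comp_continuous γ.continuous hγ
  simp [compOp, h]

theorem exists_ball_norm_sub_fderiv_le {E G : Type*} [NormedAddCommGroup E] [NormedSpace 𝕜 E]
    [NormedAddCommGroup G] [NormedSpace 𝕜 G] {F : E → G} {U C : Set E} (hU : IsOpen U)
    (hF : ContDiffOn 𝕜 1 F U) (hC : IsCompact C) (hCU : C ⊆ U) {c : ℝ} (hc : 0 < c) :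
    ∃ δ > 0, ∀ x ∈ C, ∀ y ∈ Metric.ball x δ,
      y ∈ U ∧ ‖F y - F x - fderiv 𝕜 F x (y - x)‖ ≤ c * ‖y - x‖ := by
  have hDF : ContinuousOn (fderiv 𝕜 F) U := hF.continuousOn_fderiv_of_isOpen hU (by simp)
  obtain ⟨δ₁, hδ₁, hunif⟩ := Metric.mem_uniformity_dist.1 <|
    hC.uniformContinuousAt_of_continuousAt (fderiv 𝕜 F)
      (fun a ha => hDF.continuousAt (hU.mem_nhds (hCU ha))) (Metric.dist_mem_uniformity hc)
  obtain ⟨δ₂, hδ₂, hthick⟩ := hC.exists_thickening_subset_open hU hCU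
  refine ⟨min δ₁ δ₂, lt_min hδ₁ hδ₂, fun x hx y hy => ?_⟩
  have hball : Metric.ball x (min δ₁ δ₂) ⊆ U := fun z hz =>
    hthick (Metric.mem_thickening_iff.2 ⟨x, hx, (Metric.mem_ball.1 hz).trans_le (min_le_right _ _)⟩)
  have hDF_le : ∀ z ∈ Metric.ball x (min δ₁ δ₂), ‖fderiv 𝕜 F z - fderiv 𝕜 F x‖ ≤ c := by
    intro z hz
    have hxz : dist x z < δ₁ := by
      rw [dist_comm]; exact (Metric.mem_ball.1 hz).trans_le (min_le_left _ _)
    rw [← dist_eq_norm, dist_comm]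
    exact (hunif hxz hx).le
  let : NormedSpace ℝ E := NormedSpace.restrictScalars ℝ 𝕜 E
  exact ⟨hball hy, (convex_ball x (min δ₁ δ₂)).norm_image_sub_le_of_norm_fderiv_le' (𝕜 := 𝕜)
    (fun z hz => (hF.contDiffAt (hU.mem_nhds (hball hz))).differentiableAt (by simp)) hDF_le
    (Metric.mem_ball_self (lt_min hδ₁ hδ₂)) hy⟩

variable [CompactSpace K]

theorem isOpen_forall_mem {E : Type*} [TopologicalSpace E] {U : Set E} (hU : IsOpen U) :
    IsOpen {γ : C(K, E) | ∀ k, γ k ∈ U} := by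
  simpa [Set.MapsTo] using ContinuousMap.isOpen_setOfPred_mapsTo (isCompact_univ (X := K)) hU

section

variable {E G : Type*} [NormedAddCommGroup E] [NormedSpace 𝕜 E] [NormedAddCommGroup G]
  [NormedSpace 𝕜 G]

/-- Pointwise application of a field of linear maps, as a bounded bilinear map; it expresses the
derivative of `compOp F`. -/
def pointwiseApply : C(K, E →L[𝕜] G) →L[𝕜] C(K, E) →L[𝕜] C(K, G) :=
  LinearMap.mkContinuous₂
    (LinearMap.mk₂ 𝕜 (fun (A : C(K, E →L[𝕜] G)) (h : C(K, E)) =>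
      (⟨fun k => A k (h k), by fun_prop⟩ : C(K, G)))
      (by intros; ext; simp) (by intros; ext; simp) (by intros; ext; simp)
      (by intros; ext; simp)) 1 (by
    intro A h
    rw [one_mul, ContinuousMap.norm_le _ (by positivity)]
    intro k
    exact (A k).le_of_opNorm_le_of_le (A.norm_coe_le_norm k) (h.norm_coe_le_norm k))

@[simp]
theorem pointwiseApply_apply (A : C(K, E →L[𝕜] G)) (h : C(K, E)) (k : K) :
    pointwiseApply A h k = A k (h k) := rfl

theorem hasFDerivAt_compOp {F : E → G} {U : Set E} (hU : IsOpen U) (hF : ContDiffOn 𝕜 1 F U)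
    {γ : C(K, E)} (hγ : ∀ k, γ k ∈ U) :
    HasFDerivAt (compOp (K := K) F) (pointwiseApply (compOp (fderiv 𝕜 F) γ)) γ := by
  have hDF : ContinuousOn (fderiv 𝕜 F) U := hF.continuousOn_fderiv_of_isOpen hU (by simp)
  rw [hasFDerivAt_iff_isLittleO_nhds_zero, Asymptotics.isLittleO_iff]
  intro c hc
  obtain ⟨δ, hδ, hle⟩ := exists_ball_norm_sub_fderiv_le hU hF (isCompact_range γ.continuous)
    (Set.range_subset_iff.2 hγ) hc
  filter_upwards [Metric.ball_mem_nhds (0 : C(K, E)) hδ] with h hh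
  have hmem : ∀ k, (γ + h) k ∈ Metric.ball (γ k) δ := fun k => by
    simpa using (h.norm_coe_le_norm k).trans_lt (mem_ball_zero_iff.1 hh)
  rw [ContinuousMap.norm_le _ (by positivity)]
  intro k
  have hk := (hle (γ k) (Set.mem_range_self k) _ (hmem k)).2
  rw [ContinuousMap.sub_apply, ContinuousMap.sub_apply, compOp_apply hF.continuousOn
    (fun k => (hle (γ k) (Set.mem_range_self k) _ (hmem k)).1), compOp_apply hF.continuousOn hγ,
    pointwiseApply_apply, compOp_apply hDF hγ]
  simp only [ContinuousMap.add_apply, add_sub_cancel_left] at hk ⊢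
  exact hk.trans (by gcongr; exact h.norm_coe_le_norm k)

end

theorem contDiffOn_compOp_nat {E : Type u} [NormedAddCommGroup E] [NormedSpace 𝕜 E] {U : Set E}
    (hU : IsOpen U) (n : ℕ) {G : Type u} [NormedAddCommGroup G] [NormedSpace 𝕜 G]
    {F : E → G} (hF : ContDiffOn 𝕜 (n + 1) F U) :
    ContDiffOn 𝕜 n (compOp (K := K) F) {γ | ∀ k, γ k ∈ U} := by
  induction n generalizing G with
  | zero =>
    rw [Nat.cast_zero, contDiffOn_zero]
    exact fun γ hγ => (hasFDerivAt_compOp hU (by simpa using hF)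
      hγ).continuousAt.continuousWithinAt
  | succ n ih =>
    have hF1 : ContDiffOn 𝕜 1 F U := hF.of_le le_add_self
    have hDF : ContDiffOn 𝕜 (n + 1) (fderiv 𝕜 F) U := by
      rw [contDiffOn_succ_iff_fderiv_of_isOpen hU] at hF
      exact_mod_cast hF.2.2
    rw [Nat.cast_succ, contDiffOn_succ_iff_fderiv_of_isOpen (isOpen_forall_mem hU)]
    refine ⟨fun γ hγ => (hasFDerivAt_compOp hU hF1 hγ).differentiableAt.differentiableWithinAt,
      by simp, ?_⟩
    have happly := (pointwiseApply (𝕜 := 𝕜) (K := K) (E := E) (G := G)).contDiff.comp_contDiffOn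
      (ih hDF)
    exact happly.congr fun γ hγ => (hasFDerivAt_compOp hU hF1 hγ).fderiv

theorem contDiffOn_compOp {E : Type u} [NormedAddCommGroup E] [NormedSpace 𝕜 E] {U : Set E}
    (hU : IsOpen U) {G : Type u} [NormedAddCommGroup G] [NormedSpace 𝕜 G]
    {F : E → G} (hF : ContDiffOn 𝕜 ∞ F U) :
    ContDiffOn 𝕜 ∞ (compOp (K := K) F) {γ | ∀ k, γ k ∈ U} :=
  contDiffOn_infty.2 fun n => contDiffOn_compOp_nat hU n (hF.of_le (by exact_mod_cast le_top))

end Calculus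

/-! ### Flows of holomorphic vector fields -/

section Flow

variable {𝕜 : Type*} [RCLike 𝕜]

section Primitive

variable {E : Type*} [NormedAddCommGroup E] [NormedSpace 𝕜 E] [NormedSpace ℝ E]
  [IsScalarTower ℝ 𝕜 E]

variable (𝕜) in
/-- The primitive `t ↦ ∫ s in 0..t, h s` of a continuous map on the unit interval. -/
def primitive : C(unitInterval, E) →L[𝕜] C(unitInterval, E) :=
  LinearMap.mkContinuous
    { toFun := fun h => ⟨fun t => ∫ s in (0 : ℝ)..t, Set.IccExtend zero_le_one h s,
        (intervalIntegral.continuous_primitive (fun a b =>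
          (h.continuous.Icc_extend' (h := zero_le_one)).intervalIntegrable a b) 0).comp
          continuous_subtype_val⟩
      map_add' := fun h k => by
        ext t
        exact intervalIntegral.integral_add
          ((h.continuous.Icc_extend' (h := zero_le_one)).intervalIntegrable _ _)
          ((k.continuous.Icc_extend' (h := zero_le_one)).intervalIntegrable _ _)
      map_smul' := fun c h => by
        ext t
        exact intervalIntegral.integral_smul c _ } 1 (by
    intro h
    rw [one_mul, ContinuousMap.norm_le _ (norm_nonneg _)]
    intro t
    refine (intervalIntegral.norm_integral_le_of_norm_le_const
      (fun s _ => h.norm_coe_le_norm (Set.projIcc 0 1 zero_le_one s))).trans ?_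
    rw [sub_zero, abs_of_nonneg t.2.1]
    exact mul_le_of_le_one_right (norm_nonneg _) t.2.2)

theorem primitive_apply (h : C(unitInterval, E)) (t : unitInterval) :
    primitive 𝕜 h t = ∫ s in (0 : ℝ)..t, Set.IccExtend zero_le_one h s := rfl

variable [CompleteSpace E]

theorem primitive_eq_sub_of_hasDerivAt {h : C(unitInterval, E)} {u : ℝ → E}
    (hu : ∀ t : unitInterval, HasDerivAt u (h t) t) (t : unitInterval) :
    primitive 𝕜 h t = u t - u 0 := by
  rw [primitive_apply]
  refine intervalIntegral.integral_eq_sub_of_hasDerivAt (fun s hs => ?_)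
    ((h.continuous.Icc_extend' (h := zero_le_one)).intervalIntegrable _ _)
  rw [Set.uIcc_of_le t.2.1] at hs
  have hs' : s ∈ Set.Icc (0 : ℝ) 1 := ⟨hs.1, hs.2.trans t.2.2⟩
  rw [Set.IccExtend_of_mem _ _ hs']
  exact hu ⟨s, hs'⟩

/-- For a solution `γ` of `γ' = ε • F ∘ γ`, the field `t • F (γ t)` is the variation of `γ` in the
parameter `ε`, hence solves the linearised integral equation. -/
theorem eq_primitive_of_variation {F : E → E} {U : Set E} (hU : IsOpen U)
    (hF : ContDiffOn 𝕜 1 F U) {γ : C(unitInterval, E)} (hγU : ∀ t, γ t ∈ U) {ε : 𝕜} {x : E}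
    (hγ : γ = ContinuousMap.const _ x + ε • primitive 𝕜 (compOp F γ)) {θ : C(unitInterval, E)}
    (hθ : ∀ t, θ t = (t : ℝ) • F (γ t)) :
    θ = primitive 𝕜 (compOp F γ + ε • pointwiseApply (compOp (fderiv 𝕜 F) γ) θ) := by
  have hDF : ContinuousOn (fderiv 𝕜 F) U := hF.continuousOn_fderiv_of_isOpen hU (by simp)
  let γ' : ℝ → E := fun t => x + ε • ∫ s in (0 : ℝ)..t, Set.IccExtend zero_le_one (compOp F γ) s
  have hγγ' : ∀ t : unitInterval, γ' t = γ t := fun t => (DFunLike.congr_fun hγ t).symm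
  have hγ'_deriv : ∀ t : unitInterval, HasDerivAt γ' (ε • F (γ t)) t := by
    intro t
    have hcont : Continuous (Set.IccExtend (zero_le_one (α := ℝ)) (compOp F γ)) :=
      (compOp F γ).continuous.Icc_extend'
    have h := ((hcont.integral_hasStrictDerivAt 0 t).hasDerivAt.const_smul ε).const_add x
    rwa [Set.IccExtend_of_mem _ _ t.2, compOp_apply hF.continuousOn hγU] at h
  have hFγ'_deriv : ∀ t : unitInterval,
      HasDerivAt (fun s => F (γ' s)) (fderiv 𝕜 F (γ t) (ε • F (γ t))) t := by
    intro t
    have h := ((hF.contDiffAt (hU.mem_nhds (hγU t))).differentiableAt (by simp)).hasFDerivAt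
    rw [← hγγ' t] at h
    have h' := (h.restrictScalars ℝ).comp_hasDerivAt (t : ℝ) (hγ'_deriv t)
    rw [hγγ' t] at h'
    exact h'
  ext t
  rw [primitive_eq_sub_of_hasDerivAt (u := fun s => s • F (γ' s)) fun t => ?_]
  · rw [hθ, hγγ', zero_smul, sub_zero]
  · refine ((hasDerivAt_id (t : ℝ)).smul (hFγ'_deriv t)).congr_deriv ?_
    rw [ContinuousMap.add_apply, ContinuousMap.smul_apply, pointwiseApply_apply,
      compOp_apply hF.continuousOn hγU, compOp_apply hDF hγU, hθ, hγγ', id, one_smul, map_smul,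
      ContinuousLinearMap.map_smul_of_tower, smul_comm, add_comm]

end Primitive

variable {E : Type u} [NormedAddCommGroup E] [NormedSpace 𝕜 E] [NormedSpace ℝ E]
  [IsScalarTower ℝ 𝕜 E]

variable (𝕜) in
/-- The defect `γ - x - ε ∫ F ∘ γ` of the integral form of `γ' = ε F ∘ γ`, `γ 0 = x`, on the unit
interval, as a function of `((ε, x), γ)`. -/
def flowDefect (F : E → E) (q : (𝕜 × E) × C(unitInterval, E)) : C(unitInterval, E) :=
  q.2 - ContinuousMap.const _ q.1.2 - q.1.1 • primitive 𝕜 (compOp F q.2)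

theorem contDiffOn_flowDefect {F : E → E} {U : Set E} (hU : IsOpen U) (hF : ContDiffOn 𝕜 ∞ F U) :
    ContDiffOn 𝕜 ∞ (flowDefect 𝕜 F) {q | ∀ t, q.2 t ∈ U} := by
  have hG : ContDiffOn 𝕜 ∞ (fun q : (𝕜 × E) × C(unitInterval, E) => primitive 𝕜 (compOp F q.2))
      {q | ∀ t, q.2 t ∈ U} :=
    (primitive 𝕜).contDiff.comp_contDiffOn
      ((contDiffOn_compOp hU hF).comp contDiff_snd.contDiffOn fun q hq => hq)
  let cst : E →L[𝕜] C(unitInterval, E) := ContinuousLinearMap.const 𝕜 unitInterval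
  exact (contDiffOn_snd.sub
    (cst.contDiff.comp_contDiffOn (contDiff_snd.comp contDiff_fst).contDiffOn)).sub
    ((contDiff_fst.comp contDiff_fst).contDiffOn.smul hG)

theorem fderiv_flowDefect_apply {F : E → E} {U : Set E} (hU : IsOpen U)
    (hF : ContDiffOn 𝕜 1 F U) {p : 𝕜 × E} {γ : C(unitInterval, E)} (hγ : ∀ t, γ t ∈ U)
    (w : 𝕜 × E) (η : C(unitInterval, E)) :
    fderiv 𝕜 (flowDefect 𝕜 F) (p, γ) (w, η) = η - ContinuousMap.const _ w.2 -
      primitive 𝕜 (w.1 • compOp F γ + p.1 • pointwiseApply (compOp (fderiv 𝕜 F) γ) η) := by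
  have hfst : HasFDerivAt (fun q : (𝕜 × E) × C(unitInterval, E) => q.1)
    (ContinuousLinearMap.fst 𝕜 _ _) (p, γ) := hasFDerivAt_fst
  have hsnd : HasFDerivAt (fun q : (𝕜 × E) × C(unitInterval, E) => q.2)
    (ContinuousLinearMap.snd 𝕜 _ _) (p, γ) := hasFDerivAt_snd
  have hG := (primitive 𝕜).hasFDerivAt.comp (p, γ)
    ((hasFDerivAt_compOp hU hF hγ).comp (p, γ) hsnd)
  have hconst := (ContinuousLinearMap.const 𝕜 unitInterval).hasFDerivAt.comp (p, γ) hfst.snd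
  refine (DFunLike.congr_fun ((hsnd.sub hconst).sub (hfst.fst.smul hG)).fderiv (w, η)).trans ?_
  rw [map_add, map_smul, map_smul, add_comm (w.1 • _)]
  rfl

variable [CompleteSpace E]

theorem exists_contDiffOn_integralEquation {F : E → E} {U : Set E} (hU : IsOpen U)
    (hF : ContDiffOn 𝕜 ∞ F U) {x₀ : E} (hx₀ : x₀ ∈ U) :
    ∃ (ψ : 𝕜 × E → C(unitInterval, E)) (W : Set (𝕜 × E)), IsOpen W ∧ ((0 : 𝕜), x₀) ∈ W ∧
      ContDiffOn 𝕜 ∞ ψ W ∧ ∀ p ∈ W, (∀ t, ψ p t ∈ U) ∧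
        ψ p = ContinuousMap.const _ p.2 + p.1 • primitive 𝕜 (compOp F (ψ p)) ∧
        ∀ t, fderiv 𝕜 ψ p (1, 0) t = (t : ℝ) • F (ψ p t) := by
  have hF1 : ContDiffOn 𝕜 1 F U := hF.of_le (by simp)
  let γ₀ : C(unitInterval, E) := ContinuousMap.const _ x₀
  let T : C(unitInterval, E) ≃L[𝕜] C(unitInterval, E) := ContinuousLinearEquiv.refl 𝕜 _
  have hT : ∀ η, fderiv 𝕜 (flowDefect 𝕜 F) ((0, x₀), γ₀) (0, η) = T η := fun η => by
    rw [fderiv_flowDefect_apply hU hF1 fun _ => hx₀]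
    ext t
    simp [T]
  obtain ⟨ψ, W, hW, h0W, hψ, hψW⟩ := exists_contDiffOn_implicit (G := flowDefect 𝕜 F)
    (Ω := {q | ∀ t, q.2 t ∈ U}) ((isOpen_forall_mem hU).preimage continuous_snd)
    (contDiffOn_flowDefect hU hF) (fun _ => hx₀) (by simp [flowDefect, γ₀]) hT
  refine ⟨ψ, W, hW, h0W, hψ, fun p hp => ?_⟩
  obtain ⟨hmem, hdefect, hderiv⟩ := hψW p hp
  have hsol : ψ p = ContinuousMap.const _ p.2 + p.1 • primitive 𝕜 (compOp F (ψ p)) := by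
    rw [← sub_eq_zero, ← sub_sub]
    exact hdefect
  let θ : C(unitInterval, E) := ⟨fun t => (t : ℝ) • F (ψ p t),
    continuous_subtype_val.smul (hF.continuousOn.comp_continuous (ψ p).continuous hmem)⟩
  have hθ : fderiv 𝕜 (flowDefect 𝕜 F) (p, ψ p) ((1, 0), θ) = 0 := by
    rw [fderiv_flowDefect_apply hU hF1 hmem, one_smul,
      ← eq_primitive_of_variation hU hF1 hmem hsol fun t => rfl]
    ext
    simp
  exact ⟨hmem, hsol, fun t => by rw [hderiv _ θ hθ]; rfl⟩

theorem exists_flow {F : E → E} {U : Set E} (hU : IsOpen U) (hF : ContDiffOn 𝕜 ∞ F U)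
    {x₀ : E} (hx₀ : x₀ ∈ U) :
    ∃ (Φ : 𝕜 × E → E) (W : Set (𝕜 × E)), IsOpen W ∧ ((0 : 𝕜), x₀) ∈ W ∧ ContDiffOn 𝕜 ∞ Φ W ∧
      (∀ p ∈ W, Φ p ∈ U) ∧ (∀ x, ((0 : 𝕜), x) ∈ W → Φ (0, x) = x) ∧
      ∀ p ∈ W, fderiv 𝕜 Φ p (1, 0) = F (Φ p) := by
  obtain ⟨ψ, W, hW, h0W, hψ, hψW⟩ := exists_contDiffOn_integralEquation hU hF hx₀
  let ev : C(unitInterval, E) →L[𝕜] E := ContinuousMap.evalCLM 𝕜 (1 : unitInterval)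
  refine ⟨fun p => ψ p 1, W, hW, h0W, ev.contDiff.comp_contDiffOn hψ, fun p hp => (hψW p hp).1 1,
    fun x hx => ?_, fun p hp => ?_⟩
  · have h := DFunLike.congr_fun (hψW _ hx).2.1 1
    simpa using h
  · have hψ_diff : DifferentiableAt 𝕜 ψ p :=
      (hψ.contDiffAt (hW.mem_nhds hp)).differentiableAt (by simp)
    have h : fderiv 𝕜 (fun p => ψ p 1) p (1, 0) = fderiv 𝕜 ψ p (1, 0) 1 :=
      DFunLike.congr_fun (ev.hasFDerivAt.comp p hψ_diff.hasFDerivAt).fderiv (1, 0)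
    rw [h, (hψW p hp).2.2, Set.Icc.coe_one, one_smul]

theorem exists_flowBox {F : E → E} {U : Set E} (hU : IsOpen U) (hF : ContDiffOn 𝕜 ∞ F U)
    {x₀ : E} (hx₀ : x₀ ∈ U) (h0 : F x₀ ≠ 0) :
    ∃ (Ψ : E → E) (V : Set E), IsOpen V ∧ (0 : E) ∈ V ∧ ContDiffOn 𝕜 ∞ Ψ V ∧
      (∀ u ∈ V, Ψ u ∈ U) ∧ Ψ 0 = x₀ ∧ fderiv 𝕜 Ψ 0 = ContinuousLinearMap.id 𝕜 E ∧
      ∀ u ∈ V, fderiv 𝕜 Ψ u (F x₀) = F (Ψ u) := by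
  obtain ⟨Φ, W, hW, h0W, hΦ, hΦU, hΦ0, hΦF⟩ := exists_flow hU hF hx₀
  obtain ⟨l, hl⟩ : ∃ l : E →L[𝕜] 𝕜, l (F x₀) = 1 := SeparatingDual.exists_eq_one h0
  have hΦd : ∀ p ∈ W, HasFDerivAt Φ (fderiv 𝕜 Φ p) p := fun p hp =>
    ((hΦ.contDiffAt (hW.mem_nhds hp)).differentiableAt (by simp)).hasFDerivAt
  -- `Φ ∘ j` sends `t • F x₀ + w`, where `l w = 0`, to the point reached from `x₀ + w` at time `t`.
  let D : E →L[𝕜] 𝕜 × E := l.prod (ContinuousLinearMap.id 𝕜 E - l.smulRight (F x₀))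
  let j : E → 𝕜 × E := fun u => (0, x₀) + D u
  have hj : ContDiff 𝕜 ∞ j := contDiff_const.add D.contDiff
  have hj0 : j 0 = (0, x₀) := by simp [j]
  have h0V : (0 : E) ∈ j ⁻¹' W := by rwa [Set.mem_preimage, hj0]
  have hΨ : ∀ u ∈ j ⁻¹' W, fderiv 𝕜 (Φ ∘ j) u = (fderiv 𝕜 Φ (j u)).comp D :=
    fun u hu => ((hΦd _ hu).comp u (D.hasFDerivAt.const_add _)).fderiv
  have hΨ0 : Φ (j 0) = x₀ := by rw [hj0, hΦ0 _ h0W]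
  refine ⟨Φ ∘ j, j ⁻¹' W, hW.preimage hj.continuous, h0V, hΦ.comp hj.contDiffOn fun u hu => hu,
    fun u hu => hΦU _ hu, hΨ0, ContinuousLinearMap.ext fun u => ?_, fun u hu => ?_⟩
  · have hDu : D u = l u • ((1 : 𝕜), (0 : E)) + (0, u - l u • F x₀) := by ext <;> simp [D]
    have hΦ0' : ∀ᶠ x in 𝓝 x₀, Φ (0, x) = x :=
      ((Continuous.prodMk_right (0 : 𝕜)).continuousAt.eventually (hW.mem_nhds h0W)).mono hΦ0
    rw [hΨ 0 h0V, ContinuousLinearMap.comp_apply, hDu, map_add, map_smul, hΦF _ h0V, hΨ0, hj0,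
      fderiv_prodMk_of_eventually_eq (hΦd _ h0W).differentiableAt hΦ0']
    exact add_sub_cancel _ u
  · have hDF : D (F x₀) = (1, 0) := by simp [D, hl]
    rw [hΨ u hu, ContinuousLinearMap.comp_apply, hDF, hΦF _ hu, Function.comp_apply]

theorem exists_straightening {F : E → E} {U : Set E} (hU : IsOpen U) (hF : ContDiffOn 𝕜 ∞ F U)
    {x₀ : E} (hx₀ : x₀ ∈ U) (h0 : F x₀ ≠ 0) :
    ∃ e : OpenPartialHomeomorph E E, x₀ ∈ e.source ∧ e.source ⊆ U ∧
      ContDiffOn 𝕜 ∞ e e.source ∧ ContDiffOn 𝕜 ∞ e.symm e.target ∧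
      ∀ x ∈ e.source, fderiv 𝕜 e x (F x) = F x₀ := by
  obtain ⟨Ψ, V, hV, h0V, hΨ, hΨU, hΨ0, hΨ0', hΨF⟩ := exists_flowBox hU hF hx₀ h0
  have hΨd : ∀ u ∈ V, DifferentiableAt 𝕜 Ψ u := fun u hu =>
    (hΨ.contDiffAt (hV.mem_nhds hu)).differentiableAt (by simp)
  obtain ⟨e, rfl, h0e, heV, hesymm⟩ := exists_openPartialHomeomorph_contDiffOn_symm hV hΨ h0V
    (f' := ContinuousLinearEquiv.refl 𝕜 E) ((hΨd 0 h0V).hasFDerivAt.congr_fderiv hΨ0')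
  refine ⟨e.symm, hΨ0 ▸ e.map_source h0e, fun y hy => ?_, hesymm, hΨ.mono heV, fun y hy => ?_⟩
  · exact e.right_inv hy ▸ hΨU _ (heV (e.map_target hy))
  · have hy' : e (e.symm y) = y := e.right_inv hy
    have hu : e.symm y ∈ V := heV (e.map_target hy)
    have hsymm_diff : DifferentiableAt 𝕜 e.symm y :=
      (hesymm.contDiffAt (e.open_target.mem_nhds hy)).differentiableAt (by simp)
    have hinv := fderiv_symm_fderiv (e.map_target hy) (hΨd _ hu) (hy'.symm ▸ hsymm_diff) (F x₀)
    rwa [hΨF _ hu, hy'] at hinv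

end Flow

/-! ### Real smooth maps with complex linear derivatives -/

section ComplexSmooth

theorem complex_smul_eq {V : Type*} [AddCommGroup V] [Module ℂ V] [Module ℝ V]
    [IsScalarTower ℝ ℂ V] (c : ℂ) (w : V) : c • w = c.re • w + c.im • Complex.I • w := by
  conv_lhs => rw [← Complex.re_add_im c]
  rw [add_smul, mul_smul, ← algebraMap_smul ℂ c.re w, ← algebraMap_smul ℂ c.im]
  rfl

variable {E : Type*} [NormedAddCommGroup E] [NormedSpace ℂ E] {G : Type*} [NormedAddCommGroup G]
  [NormedSpace ℂ G] {F : E → G}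

theorem differentiableAt_complex_of_fderiv_I_smul {x : E} (hF : DifferentiableAt ℝ F x)
    (hI : ∀ v, fderiv ℝ F x (Complex.I • v) = Complex.I • fderiv ℝ F x v) :
    DifferentiableAt ℂ F x := by
  let F' : E →L[ℂ] G :=
    { fderiv ℝ F x with
      map_smul' := fun c v => by
        change fderiv ℝ F x (c • v) = c • fderiv ℝ F x v
        rw [complex_smul_eq c v, complex_smul_eq c (fderiv ℝ F x v), map_add,
          map_smul, map_smul, hI] }
  exact (hasFDerivAt_of_restrictScalars ℝ (f' := F') hF.hasFDerivAt rfl).differentiableAt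

variable {U : Set E}

theorem contDiffOn_fderiv_complex [FiniteDimensional ℂ E] [FiniteDimensional ℂ G] (hU : IsOpen U)
    (hF : ContDiffOn ℝ ∞ F U) (hF' : ∀ x ∈ U, DifferentiableAt ℂ F x) :
    ContDiffOn ℝ ∞ (fderiv ℂ F) U := by
  have : FiniteDimensional ℝ E := FiniteDimensional.complexToReal E
  have : FiniteDimensional ℝ G := FiniteDimensional.complexToReal G
  let r : (E →L[ℂ] G) →L[ℝ] (E →L[ℝ] G) := ContinuousLinearMap.restrictScalarsL ℂ E G ℝ ℝ
  have hr : LinearMap.ker (r : (E →L[ℂ] G) →ₗ[ℝ] (E →L[ℝ] G)) = ⊥ :=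
    LinearMap.ker_eq_bot.2 fun A A' h =>
      ContinuousLinearMap.ext (DFunLike.congr_fun h :)
  obtain ⟨C, hC⟩ := LinearMap.exists_leftInverse_of_injective _ hr
  refine (C.toContinuousLinearMap.contDiff.comp_contDiffOn
    (hF.fderiv_of_isOpen hU le_rfl)).congr fun x hx => ?_
  rw [Function.comp_apply, (hF' x hx).fderiv_restrictScalars ℝ]
  exact (LinearMap.congr_fun hC (fderiv ℂ F x)).symm

theorem fderiv_fderiv_complex_comm (hU : IsOpen U) (hF : ContDiffOn ℝ 2 F U)
    (hF' : ∀ x ∈ U, DifferentiableAt ℂ F x) {x : E} (hx : x ∈ U)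
    (hDF : DifferentiableAt ℝ (fderiv ℂ F) x) (v w : E) :
    fderiv ℝ (fderiv ℂ F) x v w = fderiv ℝ (fderiv ℂ F) x w v := by
  let r : (E →L[ℂ] G) →L[ℝ] (E →L[ℝ] G) := ContinuousLinearMap.restrictScalarsL ℂ E G ℝ ℝ
  have hreal : fderiv ℝ F =ᶠ[𝓝 x] r ∘ fderiv ℂ F := by
    filter_upwards [hU.mem_nhds hx] with y hy using (hF' y hy).fderiv_restrictScalars ℝ
  have hsecond : fderiv ℝ (fderiv ℝ F) x = r.comp (fderiv ℝ (fderiv ℂ F) x) := by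
    rw [hreal.fderiv_eq]
    exact (r.hasFDerivAt.comp x hDF.hasFDerivAt).fderiv
  have hsymm : IsSymmSndFDerivAt ℝ F x :=
    (hF.contDiffAt (hU.mem_nhds hx)).isSymmSndFDerivAt (by simp)
  have h := hsymm v w
  rwa [hsecond] at h

theorem differentiableAt_fderiv_complex [FiniteDimensional ℂ E] [FiniteDimensional ℂ G]
    (hU : IsOpen U) (hF : ContDiffOn ℝ ∞ F U) (hF' : ∀ x ∈ U, DifferentiableAt ℂ F x)
    {x : E} (hx : x ∈ U) : DifferentiableAt ℂ (fderiv ℂ F) x := by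
  have hDF : DifferentiableAt ℝ (fderiv ℂ F) x :=
    ((contDiffOn_fderiv_complex hU hF hF').contDiffAt (hU.mem_nhds hx)).differentiableAt (by simp)
  have hcomm := fderiv_fderiv_complex_comm hU (contDiffOn_infty.1 hF 2) hF' hx hDF
  refine differentiableAt_complex_of_fderiv_I_smul hDF fun v => ContinuousLinearMap.ext fun w => ?_
  rw [hcomm, map_smul, hcomm]
  rfl

end ComplexSmooth

theorem contDiffOn_complex_nat {E : Type u} [NormedAddCommGroup E] [NormedSpace ℂ E]
    [FiniteDimensional ℂ E] {U : Set E} (hU : IsOpen U) (n : ℕ) {G : Type u}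
    [NormedAddCommGroup G] [NormedSpace ℂ G] [FiniteDimensional ℂ G] {F : E → G}
    (hF : ContDiffOn ℝ ∞ F U) (hF' : ∀ x ∈ U, DifferentiableAt ℂ F x) : ContDiffOn ℂ n F U := by
  induction n generalizing G with
  | zero => exact contDiffOn_zero.2 hF.continuousOn
  | succ n ih =>
    rw [Nat.cast_succ, contDiffOn_succ_iff_fderiv_of_isOpen hU]
    exact ⟨fun x hx => (hF' x hx).differentiableWithinAt, by simp,
      ih (contDiffOn_fderiv_complex hU hF hF') fun x hx =>
        differentiableAt_fderiv_complex hU hF hF' hx⟩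

theorem contDiffOn_complex {E : Type u} [NormedAddCommGroup E] [NormedSpace ℂ E]
    [FiniteDimensional ℂ E] {G : Type u} [NormedAddCommGroup G] [NormedSpace ℂ G]
    [FiniteDimensional ℂ G] {U : Set E} (hU : IsOpen U) {F : E → G} (hF : ContDiffOn ℝ ∞ F U)
    (hF' : ∀ x ∈ U, ∀ v, fderiv ℝ F x (Complex.I • v) = Complex.I • fderiv ℝ F x v) :
    ContDiffOn ℂ ∞ F U :=
  contDiffOn_infty.2 fun n => contDiffOn_complex_nat hU n hF fun x hx =>
    differentiableAt_complex_of_fderiv_I_smul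
      ((hF.contDiffAt (hU.mem_nhds hx)).differentiableAt (by simp)) (hF' x hx)

/-! ### Complex structure, vector fields and 1-forms -/

section VectorBundle

variable {𝕜 : Type*} [NontriviallyNormedField 𝕜]
  {EB : Type*} [NormedAddCommGroup EB] [NormedSpace 𝕜 EB] {HB : Type*} [TopologicalSpace HB]
  {IB : ModelWithCorners 𝕜 EB HB} {B : Type*} [TopologicalSpace B] [ChartedSpace HB B]
  {F₁ : Type*} [NormedAddCommGroup F₁] [NormedSpace 𝕜 F₁] [CompleteSpace F₁]
  {E₁ : B → Type*} [∀ x, AddCommGroup (E₁ x)] [∀ x, Module 𝕜 (E₁ x)]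
  [TopologicalSpace (Bundle.TotalSpace F₁ E₁)] [∀ x, TopologicalSpace (E₁ x)]
  [FiberBundle F₁ E₁] [VectorBundle 𝕜 F₁ E₁]
  {F₂ : Type*} [NormedAddCommGroup F₂] [NormedSpace 𝕜 F₂]
  {E₂ : B → Type*} [∀ x, AddCommGroup (E₂ x)] [∀ x, Module 𝕜 (E₂ x)]
  [TopologicalSpace (Bundle.TotalSpace F₂ E₂)] [∀ x, TopologicalSpace (E₂ x)]
  [FiberBundle F₂ E₂] [VectorBundle 𝕜 F₂ E₂]
  [∀ x, IsTopologicalAddGroup (E₂ x)] [∀ x, ContinuousSMul 𝕜 (E₂ x)]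

theorem contMDiffAt_of_clm_bundle_apply_eq {n : WithTop ℕ∞}
    {φ : Π x, E₁ x →L[𝕜] E₂ x} {s : Π x, E₁ x} {t : Π x, E₂ x} {x : B}
    (hφ : ContMDiffAt IB (IB.prod 𝓘(𝕜, F₁ →L[𝕜] F₂)) n
      (fun y => Bundle.TotalSpace.mk' (F₁ →L[𝕜] F₂) (E := fun y => E₁ y →L[𝕜] E₂ y) y (φ y)) x)
    (hinv : ∀ y, (φ y).IsInvertible)
    (ht : ContMDiffAt IB (IB.prod 𝓘(𝕜, F₂)) n (fun y => Bundle.TotalSpace.mk' F₂ y (t y)) x)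
    (hst : ∀ᶠ y in 𝓝 x, φ y (s y) = t y) :
    ContMDiffAt IB (IB.prod 𝓘(𝕜, F₁)) n (fun y => Bundle.TotalSpace.mk' F₁ y (s y)) x := by
  let e₁ := trivializationAt F₁ E₁ x
  let e₂ := trivializationAt F₂ E₂ x
  let Φ : B → F₁ →L[𝕜] F₂ := fun y =>
    ContinuousLinearMap.inCoordinates F₁ E₁ F₂ E₂ x y x y (φ y)
  have hΦ : ContMDiffAt IB 𝓘(𝕜, F₁ →L[𝕜] F₂) n Φ x := ((contMDiffAt_hom_bundle _).1 hφ).2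
  have hΦ_eq : ∀ y (h₁ : y ∈ e₁.baseSet) (h₂ : y ∈ e₂.baseSet),
      Φ y = (e₂.continuousLinearEquivAt 𝕜 y h₂ : E₂ y →L[𝕜] F₂) ∘L φ y ∘L
        (e₁.continuousLinearEquivAt 𝕜 y h₁).symm :=
    fun y h₁ h₂ => ContinuousLinearMap.inCoordinates_eq h₁ h₂
  have hΦ_inv : ∀ y ∈ e₁.baseSet, y ∈ e₂.baseSet → (Φ y).IsInvertible := by
    intro y h₁ h₂
    rw [hΦ_eq y h₁ h₂]
    simpa using hinv y
  have hx₁ : x ∈ e₁.baseSet := FiberBundle.mem_baseSet_trivializationAt' x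
  have hx₂ : x ∈ e₂.baseSet := FiberBundle.mem_baseSet_trivializationAt' x
  rw [Bundle.contMDiffAt_section] at ht ⊢
  have hΦinv : ContMDiffAt IB 𝓘(𝕜, F₂ →L[𝕜] F₁) n (fun y => (Φ y).inverse) x :=
    (hΦ_inv x hx₁ hx₂).contDiffAt_map_inverse.contMDiffAt.comp x hΦ
  refine (hΦinv.clm_apply ht).congr_of_eventuallyEq ?_
  filter_upwards [e₁.open_baseSet.mem_nhds hx₁, e₂.open_baseSet.mem_nhds hx₂, hst] with y h₁ h₂ hy
  refine ((hΦ_inv y h₁ h₂).inverse_apply_eq.2 ?_).symm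
  change e₂.continuousLinearEquivAt 𝕜 y h₂ (t y) = Φ y (e₁.continuousLinearEquivAt 𝕜 y h₁ (s y))
  rw [hΦ_eq y h₁ h₂, ContinuousLinearMap.comp_apply, ContinuousLinearMap.comp_apply,
    ContinuousLinearEquiv.coe_coe, ContinuousLinearEquiv.coe_coe,
    ContinuousLinearEquiv.symm_apply_apply, hy]

end VectorBundle

section VectorFields

variable {E : Type*} [NormedAddCommGroup E] [NormedSpace ℂ E]
  {M : Type*} [TopologicalSpace M] [ChartedSpace E M]

theorem complexStructure_complexStructure (x : M) (v : TangentSpace 𝓘(ℝ, E) x) :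
    complexStructure x (complexStructure x v) = -v := by
  change Complex.I • (Complex.I • (show E from v)) = -(show E from v)
  rw [smul_smul, Complex.I_mul_I, neg_one_smul]

/-- The vector field `X` is smooth at `x`; the smooth analogue of `IsDiffAt`. -/
abbrev IsSmoothAt [IsManifold 𝓘(ℂ, E) ω M] (X : Π x : M, TangentSpace 𝓘(ℝ, E) x) (x : M) : Prop :=
  ContMDiffAt 𝓘(ℝ, E) 𝓘(ℝ, E).tangent ∞ (fun y => (⟨y, X y⟩ : TangentBundle 𝓘(ℝ, E) M)) x

variable [IsManifold 𝓘(ℂ, E) ω M]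

theorem tangentCoordChange_I_smul {x y z : M} (hx : z ∈ (chartAt E x).source)
    (hy : z ∈ (chartAt E y).source) (v : E) :
    tangentCoordChange 𝓘(ℝ, E) x y z (Complex.I • v) =
      Complex.I • tangentCoordChange 𝓘(ℝ, E) x y z v := by
  have h1 := hasFDerivWithinAt_tangentCoordChange (I := 𝓘(ℝ, E)) (x := x) (y := y) (z := z)
    (by simpa using ⟨hx, hy⟩)
  have : IsManifold 𝓘(ℂ, E) 1 M := .of_le (n := ω) le_top
  have h2 := (hasFDerivWithinAt_tangentCoordChange (I := 𝓘(ℂ, E)) (x := x) (y := y) (z := z)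
    (by simpa using ⟨hx, hy⟩)).restrictScalars ℝ
  simp only [mfld_simps, hasFDerivWithinAt_univ] at h1 h2
  rw [h1.unique h2]
  simp

theorem tangentCoordChange_complexStructure {x y : M} (hx : y ∈ (chartAt E x).source)
    (v : TangentSpace 𝓘(ℝ, E) y) :
    tangentCoordChange 𝓘(ℝ, E) y x y (complexStructure y v) =
      Complex.I • tangentCoordChange 𝓘(ℝ, E) y x y v :=
  tangentCoordChange_I_smul (mem_chart_source E y) hx v

theorem isSmoothAt_iff {X : Π x : M, TangentSpace 𝓘(ℝ, E) x} {x x₀ : M}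
    (hx : x ∈ (chartAt E x₀).source) :
    IsSmoothAt X x ↔ ContMDiffAt 𝓘(ℝ, E) 𝓘(ℝ, E) ∞
      (fun y => tangentCoordChange 𝓘(ℝ, E) y x₀ y (X y)) x :=
  (trivializationAt E (TangentSpace 𝓘(ℝ, E)) x₀).contMDiffAt_section_iff
    (IB := 𝓘(ℝ, E)) (n := ∞) (s := X) hx

theorem isDiffAt_iff {X : Π x : M, TangentSpace 𝓘(ℝ, E) x} {x x₀ : M}
    (hx : x ∈ (chartAt E x₀).source) :
    IsDiffAt X x ↔ MDifferentiableAt 𝓘(ℝ, E) 𝓘(ℝ, E)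
      (fun y => tangentCoordChange 𝓘(ℝ, E) y x₀ y (X y)) x :=
  (trivializationAt E (TangentSpace 𝓘(ℝ, E)) x₀).mdifferentiableAt_section_iff
    (IB := 𝓘(ℝ, E)) (s := X) hx

theorem IsSmoothAt.isDiffAt {X : Π x : M, TangentSpace 𝓘(ℝ, E) x} {x : M} (hX : IsSmoothAt X x) :
    IsDiffAt X x :=
  hX.mdifferentiableAt (by simp)

theorem IsSmoothAt.complexStructure {X : Π x : M, TangentSpace 𝓘(ℝ, E) x} {x : M}
    (hX : IsSmoothAt X x) : IsSmoothAt (fun y => complexStructure y (X y)) x := by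
  rw [isSmoothAt_iff (mem_chart_source E x)] at hX ⊢
  refine (((Complex.I • ContinuousLinearMap.id ℂ E).restrictScalars ℝ).contMDiff.contMDiffAt.comp x
    hX).congr_of_eventuallyEq ?_
  filter_upwards [(chartAt E x).open_source.mem_nhds (mem_chart_source E x)] with y hy
  exact tangentCoordChange_complexStructure hy (X y)

theorem IsDiffAt.complexStructure {X : Π x : M, TangentSpace 𝓘(ℝ, E) x} {x : M}
    (hX : IsDiffAt X x) : IsDiffAt (fun y => complexStructure y (X y)) x := by
  rw [isDiffAt_iff (mem_chart_source E x)] at hX ⊢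
  refine ((((Complex.I • ContinuousLinearMap.id ℂ E).restrictScalars
    ℝ).contMDiff (n := 1)).contMDiffAt.mdifferentiableAt one_ne_zero |>.comp x
    hX).congr_of_eventuallyEq ?_
  filter_upwards [(chartAt E x).open_source.mem_nhds (mem_chart_source E x)] with y hy
  exact tangentCoordChange_complexStructure hy (X y)

theorem exists_isSmoothAt (x : M) (v : TangentSpace 𝓘(ℝ, E) x) :
    ∃ X : Π x : M, TangentSpace 𝓘(ℝ, E) x, IsSmoothAt X x ∧ X x = v :=
  ⟨FiberBundle.extend E v, FiberBundle.contMDiffAt_extend 𝓘(ℝ, E) E v, by simp⟩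

theorem IsDiffAt.metric {g : Π x : M, TangentSpace 𝓘(ℝ, E) x →L[ℝ] TangentSpace 𝓘(ℝ, E) x →L[ℝ] ℝ}
    {ν : ℕ} (hg : IsHermitianMetric g ν) {X Y : Π x : M, TangentSpace 𝓘(ℝ, E) x} {x : M}
    (hX : IsDiffAt X x) (hY : IsDiffAt Y x) :
    MDifferentiableAt 𝓘(ℝ, E) 𝓘(ℝ, ℝ) (fun y => g y (X y) (Y y)) x := by
  have h := MDifferentiableAt.clm_bundle_apply₂ (F₁ := E) (F₂ := E) (F₃ := ℝ) (IB := 𝓘(ℝ, E))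
    (E₃ := fun _ : M => ℝ) (b := id) ((hg.contMDiff.contMDiffAt (x := x)).mdifferentiableAt
      (by simp)) hX hY
  simp only [mdifferentiableAt_totalSpace] at h
  exact h.2

end VectorFields

section MetricDual

variable {E : Type*} [NormedAddCommGroup E] [NormedSpace ℂ E]
  {M : Type*} [TopologicalSpace M] [ChartedSpace E M] [IsManifold 𝓘(ℂ, E) ω M]
  {g : Π x : M, TangentSpace 𝓘(ℝ, E) x →L[ℝ] TangentSpace 𝓘(ℝ, E) x →L[ℝ] ℝ} {ν : ℕ}

theorem IsHermitianMetric.isInvertible [FiniteDimensional ℂ E] (hg : IsHermitianMetric g ν)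
    (x : M) : (g x).IsInvertible := by
  have : FiniteDimensional ℝ E := FiniteDimensional.complexToReal E
  have : FiniteDimensional ℝ (TangentSpace 𝓘(ℝ, E) x) := this
  have : T2Space (TangentSpace 𝓘(ℝ, E) x) := inferInstanceAs (T2Space E)
  have hinj : Function.Injective (g x : TangentSpace 𝓘(ℝ, E) x →ₗ[ℝ] _) :=
    (injective_iff_map_eq_zero _).2 fun v hv => hg.nondegenerate x v fun w =>
      DFunLike.congr_fun (F := TangentSpace 𝓘(ℝ, E) x →L[ℝ] ℝ) hv w
  have hdim : Module.finrank ℝ (TangentSpace 𝓘(ℝ, E) x) =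
      Module.finrank ℝ (TangentSpace 𝓘(ℝ, E) x →L[ℝ] ℝ) := by
    rw [← LinearMap.toContinuousLinearMap.finrank_eq]
    exact Subspace.dual_finrank_eq.symm
  exact ⟨(LinearEquiv.ofInjectiveOfFinrankEq _ hinj hdim).toContinuousLinearEquiv, rfl⟩

theorem IsHermitianMetric.isSmoothAt_of_eq [FiniteDimensional ℂ E] (hg : IsHermitianMetric g ν)
    {X : Π x : M, TangentSpace 𝓘(ℝ, E) x} {α : Π x : M, TangentSpace 𝓘(ℝ, E) x →L[ℝ] ℝ} {x : M}
    (hα : ContMDiffAt 𝓘(ℝ, E) (𝓘(ℝ, E).prod 𝓘(ℝ, E →L[ℝ] ℝ)) ∞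
      (fun y => Bundle.TotalSpace.mk' (E →L[ℝ] ℝ)
        (E := fun y : M => TangentSpace 𝓘(ℝ, E) y →L[ℝ] ℝ) y (α y)) x)
    (hX : ∀ᶠ y in 𝓝 x, g y (X y) = α y) : IsSmoothAt X x := by
  have : FiniteDimensional ℝ E := FiniteDimensional.complexToReal E
  have : CompleteSpace E := FiniteDimensional.complete ℝ E
  exact contMDiffAt_of_clm_bundle_apply_eq hg.contMDiff.contMDiffAt hg.isInvertible hα hX

theorem contMDiffAt_mvfderiv {f : M → ℝ} {x : M} (hf : ContMDiffAt 𝓘(ℝ, E) 𝓘(ℝ, ℝ) ∞ f x) :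
    ContMDiffAt 𝓘(ℝ, E) (𝓘(ℝ, E).prod 𝓘(ℝ, E →L[ℝ] ℝ)) ∞
      (fun y => Bundle.TotalSpace.mk' (E →L[ℝ] ℝ)
        (E := fun y : M => TangentSpace 𝓘(ℝ, E) y →L[ℝ] ℝ) y (mvfderiv 𝓘(ℝ, E) f y)) x := by
  rw [contMDiffAt_hom_bundle]
  refine ⟨contMDiffAt_id, (hf.mfderiv_const (m := ∞) (by simp)).congr_of_eventuallyEq ?_⟩
  filter_upwards [(chartAt E x).open_source.mem_nhds (mem_chart_source E x)] with y _
  ext v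
  simp only [inTangentCoordinates, ContinuousLinearMap.inCoordinates,
    ContinuousLinearMap.comp_apply, TangentBundle.continuousLinearMapAt_model_space]
  simp only [Bundle.Trivial.fiberBundle_trivializationAt',
    Bundle.Trivial.continuousLinearMapAt_trivialization, ContinuousLinearMap.id_apply, id_eq]
  rfl

theorem IsLeeField.isSmoothAt [FiniteDimensional ℂ E] (hg : IsHermitianMetric g ν)
    {lee : Π x : M, TangentSpace 𝓘(ℝ, E) x →L[ℝ] ℝ} (hlck : IsLocallyConformalKahler g lee)
    {B : Π x : M, TangentSpace 𝓘(ℝ, E) x} (hB : IsLeeField g lee B) (x : M) :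
    IsSmoothAt B x := by
  obtain ⟨U, f, hU, hxU, hf, -, hlee⟩ := hlck x
  refine hg.isSmoothAt_of_eq (contMDiffAt_mvfderiv (hf.contMDiffAt (hU.mem_nhds hxU))) ?_
  filter_upwards [hU.mem_nhds hxU] with y hy
  rw [← hlee y hy]
  ext v
  rw [hg.symm, hB]

end MetricDual

/-! ### The Levi-Civita connection and conformal changes of the metric -/

section Connections

variable {E : Type*} [NormedAddCommGroup E] [NormedSpace ℂ E]
  {M : Type*} [TopologicalSpace M] [ChartedSpace E M]
  {g : Π x : M, TangentSpace 𝓘(ℝ, E) x →L[ℝ] TangentSpace 𝓘(ℝ, E) x →L[ℝ] ℝ} {ν : ℕ}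
  {lee : Π x : M, TangentSpace 𝓘(ℝ, E) x →L[ℝ] ℝ}
  {nabla nabla' : (Π x : M, TangentSpace 𝓘(ℝ, E) x) →
      (Π x : M, TangentSpace 𝓘(ℝ, E) x →L[ℝ] TangentSpace 𝓘(ℝ, E) x)}
  {B : Π x : M, TangentSpace 𝓘(ℝ, E) x} {U U' : Set M} {x : M}

/-- The Weyl connection `∇_v Y - ½ (ω(v) Y + ω(Y) v - g(Y, v) B)` of `g` and `ω`. It is the
Levi-Civita connection of `e^{-f} g` wherever `ω = df`. -/
def weylConnection (g : Π x : M, TangentSpace 𝓘(ℝ, E) x →L[ℝ] TangentSpace 𝓘(ℝ, E) x →L[ℝ] ℝ)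
    (lee : Π x : M, TangentSpace 𝓘(ℝ, E) x →L[ℝ] ℝ) (B : Π x : M, TangentSpace 𝓘(ℝ, E) x)
    (nabla : (Π x : M, TangentSpace 𝓘(ℝ, E) x) →
      (Π x : M, TangentSpace 𝓘(ℝ, E) x →L[ℝ] TangentSpace 𝓘(ℝ, E) x))
    (Y : Π x : M, TangentSpace 𝓘(ℝ, E) x) (x : M) :
    TangentSpace 𝓘(ℝ, E) x →L[ℝ] TangentSpace 𝓘(ℝ, E) x :=
  nabla Y x - (2⁻¹ : ℝ) • ((lee x).smulRight (Y x) + lee x (Y x) • .id ℝ _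
    - (g x (Y x)).smulRight (B x))

theorem weylConnection_apply (Y : Π x : M, TangentSpace 𝓘(ℝ, E) x)
    (v : TangentSpace 𝓘(ℝ, E) x) :
    weylConnection g lee B nabla Y x v = nabla Y x v -
      (2⁻¹ : ℝ) • (lee x v • Y x + lee x (Y x) • v - g x (Y x) v • B x) :=
  rfl

variable [IsManifold 𝓘(ℂ, E) ω M]

theorem IsLeviCivitaOn.eq_of_isDiffAt
    {h : Π x : M, TangentSpace 𝓘(ℝ, E) x →L[ℝ] TangentSpace 𝓘(ℝ, E) x →L[ℝ] ℝ}
    (hsymm : ∀ v w, h x v w = h x w v) (hnondeg : ∀ v, (∀ w, h x v w = 0) → v = 0)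
    (hnabla : IsLeviCivitaOn h nabla U) (hnabla' : IsLeviCivitaOn h nabla' U')
    (hx : x ∈ U) (hx' : x ∈ U') {Y : Π x : M, TangentSpace 𝓘(ℝ, E) x} (hY : IsDiffAt Y x) :
    nabla Y x = nabla' Y x := by
  -- The difference tensor is symmetric in its two arguments and skew for `h`, hence zero.
  let S (X Y : Π x : M, TangentSpace 𝓘(ℝ, E) x) := nabla Y x (X x) - nabla' Y x (X x)
  have hS_symm : ∀ X Y, IsDiffAt X x → IsDiffAt Y x → S X Y = S Y X := by
    intro X Y hX hY
    have h₁ := hnabla.torsionFree x hx X Y hX hY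
    rw [← hnabla'.torsionFree x hx' X Y hX hY] at h₁
    rwa [sub_eq_sub_iff_sub_eq_sub]
  have hS_skew : ∀ X Y Z, IsDiffAt Y x → IsDiffAt Z x →
      h x (S X Y) (Z x) + h x (Y x) (S X Z) = 0 := by
    intro X Y Z hY hZ
    have h₁ := hnabla.metric x hx Y Z hY hZ (X x)
    rw [hnabla'.metric x hx' Y Z hY hZ (X x)] at h₁
    simp only [S, map_sub, _root_.sub_apply]
    linarith
  ext1 v
  obtain ⟨X, hX, rfl⟩ := exists_isSmoothAt x v
  refine sub_eq_zero.1 (hnondeg (S X Y) fun w => ?_)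
  obtain ⟨Z, hZ, rfl⟩ := exists_isSmoothAt x w
  replace hX := hX.isDiffAt
  replace hZ := hZ.isDiffAt
  have h₁ := hS_skew X Y Z hY hZ
  have h₂ := hS_skew Y Z X hZ hX
  have h₃ := hS_skew Z X Y hX hY
  rw [hS_symm X Z hX hZ, hsymm (Y x)] at h₁
  rw [hS_symm Y X hY hX, hsymm (Z x)] at h₂
  rw [hS_symm Z Y hZ hY, hsymm (X x)] at h₃
  linarith

theorem IsLeviCivitaOn.nabla_congr_of_comp_eventuallyEq (hg : IsHermitianMetric g ν)
    (hnabla : IsLeviCivitaOn g nabla Set.univ)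
    {F H N : Type*} [NormedAddCommGroup F] [NormedSpace ℝ F] [TopologicalSpace H]
    {I : ModelWithCorners ℝ F H} [TopologicalSpace N] [ChartedSpace H N] {j : N → M} {p : N}
    (hj : MDifferentiableAt I 𝓘(ℝ, E) j p) (v : TangentSpace I p)
    {Y Z : Π x : M, TangentSpace 𝓘(ℝ, E) x} (hY : IsDiffAt Y (j p)) (hZ : IsDiffAt Z (j p))
    (hYZ : ∀ᶠ q in 𝓝 p, Y (j q) = Z (j q)) :
    nabla Y (j p) (mfderiv I 𝓘(ℝ, E) j p v) = nabla Z (j p) (mfderiv I 𝓘(ℝ, E) j p v) := by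
  refine sub_eq_zero.1 (hg.nondegenerate _ _ fun w => ?_)
  obtain ⟨W, hW, rfl⟩ := exists_isSmoothAt (j p) w
  have hpair : (fun x => g x (Y x) (W x)) ∘ j =ᶠ[𝓝 p] (fun x => g x (Z x) (W x)) ∘ j := by
    filter_upwards [hYZ] with q hq
    simp only [Function.comp_apply, hq]
  have h₁ := mvfderiv_comp_apply p (hY.metric hg hW.isDiffAt) hj v
  have h₂ := mvfderiv_comp_apply p (hZ.metric hg hW.isDiffAt) hj v
  rw [hnabla.metric (j p) trivial Y W hY hW.isDiffAt] at h₁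
  rw [hnabla.metric (j p) trivial Z W hZ hW.isDiffAt, ← hYZ.self_of_nhds] at h₂
  have h₃ : mvfderiv I ((fun x => g x (Y x) (W x)) ∘ j) p v =
      mvfderiv I ((fun x => g x (Z x) (W x)) ∘ j) p v := by
    rw [mvfderiv, mvfderiv, hpair.mfderiv_eq, hpair.self_of_nhds]
  rw [h₁, h₂] at h₃
  rw [map_sub, _root_.sub_apply]
  linarith

theorem isCovariantDerivativeOn_weylConnection (hnabla : IsCovariantDerivativeOn E nabla U) :
    IsCovariantDerivativeOn E (weylConnection g lee B nabla) U where
  add hσ hσ' hx := by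
    ext v
    simp only [weylConnection_apply, hnabla.add hσ hσ', Pi.add_apply, map_add, _root_.add_apply]
    module
  leibniz hσ hf hx := by
    ext v
    simp only [weylConnection_apply, hnabla.leibniz hσ hf, Pi.smul_apply', map_smul,
      _root_.add_apply, _root_.smul_apply, smul_eq_mul]
    module

theorem mvfderiv_exp_neg_smul_metric (hg : IsHermitianMetric g ν) {f : M → ℝ}
    (hf : MDifferentiableAt 𝓘(ℝ, E) 𝓘(ℝ, ℝ) f x) {X Y : Π x : M, TangentSpace 𝓘(ℝ, E) x}
    (hX : IsDiffAt X x) (hY : IsDiffAt Y x) (v : TangentSpace 𝓘(ℝ, E) x) :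
    mvfderiv 𝓘(ℝ, E) (fun y => (Real.exp (-f y) • g y) (X y) (Y y)) x v =
      Real.exp (-f x) * (mvfderiv 𝓘(ℝ, E) (fun y => g y (X y) (Y y)) x v
        - mvfderiv 𝓘(ℝ, E) f x v * g x (X x) (Y x)) := by
  have hd : MDifferentiableAt 𝓘(ℝ, ℝ) 𝓘(ℝ, ℝ) Real.exp ((-f) x) :=
    Real.differentiable_exp.mdifferentiable.mdifferentiableAt
  have hexp : mvfderiv 𝓘(ℝ, E) (Real.exp ∘ (-f)) x v =
      -(Real.exp (-f x) * mvfderiv 𝓘(ℝ, E) f x v) := by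
    have hchain : mvfderiv 𝓘(ℝ, E) (Real.exp ∘ (-f)) x v =
        fderiv ℝ Real.exp (-f x) (mvfderiv 𝓘(ℝ, E) (-f) x v) := by
      rw [mvfderiv_comp_apply x hd hf.neg v, mvfderiv, mfderiv_eq_fderiv]
      rfl
    rw [hchain, mvfderiv_neg, (Real.hasDerivAt_exp _).hasFDerivAt.fderiv]
    simp [mul_comm]
  change mvfderiv 𝓘(ℝ, E) ((Real.exp ∘ (-f)) * fun y => g y (X y) (Y y)) x v = _
  rw [mvfderiv_mul (hd.comp x hf.neg) (hX.metric hg hY)]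
  simp only [_root_.add_apply, _root_.smul_apply, smul_eq_mul, hexp, Function.comp_apply,
    Pi.neg_apply]
  ring

theorem IsLeeField.apply_left (hg : IsHermitianMetric g ν) (hB : IsLeeField g lee B) (x : M)
    (v : TangentSpace 𝓘(ℝ, E) x) : g x (B x) v = lee x v := by
  rw [hg.symm, hB]

theorem isLeviCivitaOn_weylConnection (hg : IsHermitianMetric g ν)
    (hnabla : IsLeviCivitaOn g nabla U) (hB : IsLeeField g lee B) {f : M → ℝ}
    (hf : ∀ x ∈ U, MDifferentiableAt 𝓘(ℝ, E) 𝓘(ℝ, ℝ) f x)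
    (hlee : ∀ x ∈ U, lee x = mvfderiv 𝓘(ℝ, E) f x) :
    IsLeviCivitaOn (fun y => Real.exp (-f y) • g y) (weylConnection g lee B nabla) U where
  isCovariantDerivativeOn :=
    isCovariantDerivativeOn_weylConnection hnabla.isCovariantDerivativeOn
  torsionFree x hx X Y hX hY := by
    rw [← hnabla.torsionFree x hx X Y hX hY, weylConnection_apply, weylConnection_apply,
      hg.symm x (Y x)]
    module
  metric x hx X Y hX hY v := by
    rw [mvfderiv_exp_neg_smul_metric hg (hf x hx) hX hY, hnabla.metric x hx X Y hX hY, ← hlee x hx]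
    simp only [weylConnection_apply, map_add, map_sub, map_smul, _root_.add_apply,
      _root_.sub_apply, _root_.smul_apply, smul_eq_mul, hB _ _, hB.apply_left hg]
    rw [hg.symm x (X x) (Y x), hg.symm x v (Y x)]
    ring

theorem IsLocallyConformalKahler.weylConnection_complexStructure
    (hlck : IsLocallyConformalKahler g lee) (hg : IsHermitianMetric g ν)
    (hnabla : IsLeviCivitaOn g nabla Set.univ) (hB : IsLeeField g lee B)
    {Y : Π x : M, TangentSpace 𝓘(ℝ, E) x} (hY : IsDiffAt Y x) (v : TangentSpace 𝓘(ℝ, E) x) :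
    weylConnection g lee B nabla (fun y => complexStructure y (Y y)) x v =
      complexStructure x (weylConnection g lee B nabla Y x v) := by
  obtain ⟨U, f, hU, hxU, hf, ⟨nabla', hnabla', hJ⟩, hlee⟩ := hlck x
  have hfd : ∀ y ∈ U, MDifferentiableAt 𝓘(ℝ, E) 𝓘(ℝ, ℝ) f y := fun y hy =>
    (hf.contMDiffAt (hU.mem_nhds hy)).mdifferentiableAt (by simp)
  have hW := isLeviCivitaOn_weylConnection hg
    { isCovariantDerivativeOn := hnabla.isCovariantDerivativeOn.mono (Set.subset_univ U)
      torsionFree := fun y _ => hnabla.torsionFree y trivial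
      metric := fun y _ => hnabla.metric y trivial } hB hfd hlee
  have heq : ∀ {Z}, IsDiffAt Z x → weylConnection g lee B nabla Z x = nabla' Z x :=
    hW.eq_of_isDiffAt (fun v w => congrArg (Real.exp (-f x) * ·) (hg.symm x v w))
      (fun v hv => hg.nondegenerate x v fun w =>
        (mul_eq_zero.1 (hv w)).resolve_left (Real.exp_ne_zero _)) hnabla' hxU hxU
  rw [heq hY, heq hY.complexStructure, hJ x hxU Y hY v]

end Connections

/-! ### The Lee field, the anti-Lee field and the plane they span -/

section LeePlane

variable {E : Type*} [NormedAddCommGroup E] [NormedSpace ℂ E]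
  {M : Type*} [TopologicalSpace M] [ChartedSpace E M]
  {B : Π x : M, TangentSpace 𝓘(ℝ, E) x} {x : M}

theorem antiLee_mem_leePlane (x : M) : antiLee B x ∈ leePlane B x :=
  Submodule.subset_span (by simp)

theorem leeField_mem_leePlane (x : M) : B x ∈ leePlane B x :=
  Submodule.subset_span (by simp)

theorem linearIndependent_antiLee (hx : B x ≠ 0) : LinearIndependent ℝ ![antiLee B x, B x] := by
  rw [LinearIndependent.pair_iff]
  intro s t h
  have hsmul : ((t : ℂ) - s * Complex.I) • (show E from B x) = 0 := by
    rw [sub_smul, mul_smul, Complex.coe_smul, Complex.coe_smul, sub_eq_neg_add, ← smul_neg]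
    exact h
  simpa [Complex.ext_iff, and_comm] using (smul_eq_zero.1 hsmul).resolve_right hx

theorem leePlane_eq_span_range (x : M) :
    leePlane B x = Submodule.span ℝ (Set.range ![antiLee B x, B x]) := by
  rw [leePlane, Matrix.range_cons_cons_empty]

theorem finrank_leePlane (hx : B x ≠ 0) : Module.finrank ℝ (leePlane B x) = 2 := by
  rw [leePlane_eq_span_range]
  exact finrank_span_eq_card (linearIndependent_antiLee hx)

end LeePlane

section Vaisman

variable {E : Type*} [NormedAddCommGroup E] [NormedSpace ℂ E]
  {M : Type*} [TopologicalSpace M] [ChartedSpace E M] [IsManifold 𝓘(ℂ, E) ω M]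
  {g : Π x : M, TangentSpace 𝓘(ℝ, E) x →L[ℝ] TangentSpace 𝓘(ℝ, E) x →L[ℝ] ℝ} {ν : ℕ}
  {lee : Π x : M, TangentSpace 𝓘(ℝ, E) x →L[ℝ] ℝ}
  {nabla : (Π x : M, TangentSpace 𝓘(ℝ, E) x) →
      (Π x : M, TangentSpace 𝓘(ℝ, E) x →L[ℝ] TangentSpace 𝓘(ℝ, E) x)}
  {B : Π x : M, TangentSpace 𝓘(ℝ, E) x} {x : M}

theorem IsSmoothAt.antiLee (hB : IsSmoothAt B x) : IsSmoothAt (antiLee B) x :=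
  hB.complexStructure.neg_section

theorem IsHermitianMetric.complexStructure_left (hg : IsHermitianMetric g ν) (x : M)
    (v w : TangentSpace 𝓘(ℝ, E) x) :
    g x (complexStructure x v) w = -g x v (complexStructure x w) := by
  have h := hg.hermitian x v (complexStructure x w)
  rw [complexStructure_complexStructure, map_neg] at h
  linarith

theorem IsHermitianMetric.complexStructure_self (hg : IsHermitianMetric g ν) (x : M)
    (v : TangentSpace 𝓘(ℝ, E) x) : g x (complexStructure x v) v = 0 := by
  have h := hg.complexStructure_left x v v
  rw [hg.symm x v] at h
  linarith

theorem IsLeeField.nabla_eq_zero (hg : IsHermitianMetric g ν)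
    (hnabla : IsLeviCivitaOn g nabla Set.univ) (hlee : IsParallelForm nabla lee)
    (hB : IsLeeField g lee B) (hBx : IsDiffAt B x) : nabla B x = 0 := by
  ext1 v
  refine hg.nondegenerate x _ fun w => ?_
  obtain ⟨Y, hY, rfl⟩ := exists_isSmoothAt x w
  have h₁ := hlee x Y hY.isDiffAt v
  have h₂ := hnabla.metric x trivial Y B hY.isDiffAt hBx v
  simp only [hB _ _] at h₂
  rw [hg.symm]
  linarith

/-- A Vaisman structure: a locally conformal Kähler metric `g` whose Lee form is parallel, together
with its Levi-Civita connection and its Lee field. -/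
structure IsVaisman
    (g : Π x : M, TangentSpace 𝓘(ℝ, E) x →L[ℝ] TangentSpace 𝓘(ℝ, E) x →L[ℝ] ℝ) (ν : ℕ)
    (lee : Π x : M, TangentSpace 𝓘(ℝ, E) x →L[ℝ] ℝ)
    (nabla : (Π x : M, TangentSpace 𝓘(ℝ, E) x) →
      (Π x : M, TangentSpace 𝓘(ℝ, E) x →L[ℝ] TangentSpace 𝓘(ℝ, E) x))
    (B : Π x : M, TangentSpace 𝓘(ℝ, E) x) : Prop where
  isHermitianMetric : IsHermitianMetric g ν
  isLocallyConformalKahler : IsLocallyConformalKahler g lee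
  isLeviCivitaOn : IsLeviCivitaOn g nabla Set.univ
  isParallelForm : IsParallelForm nabla lee
  isLeeField : IsLeeField g lee B

namespace IsVaisman

theorem isSmoothAt_leeField [FiniteDimensional ℂ E] (hV : IsVaisman g ν lee nabla B) (x : M) :
    IsSmoothAt B x :=
  hV.isLeeField.isSmoothAt hV.isHermitianMetric hV.isLocallyConformalKahler x

theorem nabla_leeField [FiniteDimensional ℂ E] (hV : IsVaisman g ν lee nabla B) (x : M) :
    nabla B x = 0 :=
  hV.isLeeField.nabla_eq_zero hV.isHermitianMetric hV.isLeviCivitaOn hV.isParallelForm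
    (hV.isSmoothAt_leeField x).isDiffAt

theorem mvfderiv_leeField_sq [FiniteDimensional ℂ E] (hV : IsVaisman g ν lee nabla B) (x : M) :
    mvfderiv 𝓘(ℝ, E) (fun y => g y (B y) (B y)) x = 0 := by
  have hB := (hV.isSmoothAt_leeField x).isDiffAt
  ext v
  simp [hV.isLeviCivitaOn.metric x trivial B B hB hB v, hV.nabla_leeField]

theorem nabla_complexStructure_leeField [FiniteDimensional ℂ E]
    (hV : IsVaisman g ν lee nabla B) (v : TangentSpace 𝓘(ℝ, E) x) :
    nabla (fun y => complexStructure y (B y)) x v = -(2⁻¹ : ℝ) •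
      (g x (B x) (B x) • complexStructure x v + g x v (complexStructure x (B x)) • B x
        - lee x v • complexStructure x (B x)) := by
  have hg := hV.isHermitianMetric
  have h := hV.isLocallyConformalKahler.weylConnection_complexStructure hg hV.isLeviCivitaOn
    hV.isLeeField (hV.isSmoothAt_leeField x).isDiffAt v
  have hJB : lee x (complexStructure x (B x)) = 0 := by
    rw [← hV.isLeeField, hg.complexStructure_self]
  simp only [weylConnection_apply, hV.nabla_leeField, _root_.zero_apply, hJB,
    hV.isLeeField.apply_left hg, map_sub, map_add, map_smul, map_zero] at h
  rw [eq_add_of_sub_eq h, hV.isLeeField x (B x), hg.symm x (complexStructure x (B x))]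
  module

theorem nabla_antiLee [FiniteDimensional ℂ E] (hV : IsVaisman g ν lee nabla B)
    (v : TangentSpace 𝓘(ℝ, E) x) (hv : v ∈ leePlane B x) : nabla (antiLee B) x v = 0 := by
  have hg := hV.isHermitianMetric
  have hA : nabla (antiLee B) x = (-1 : ℝ) • nabla (fun y => complexStructure y (B y)) x := by
    rw [← hV.isLeviCivitaOn.isCovariantDerivativeOn.smul_const (-1 : ℝ)
      (hV.isSmoothAt_leeField x).isDiffAt.complexStructure]
    congr 1
    ext y
    simp [antiLee]
  have hBJB : g x (B x) (complexStructure x (B x)) = 0 := by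
    rw [hg.symm, hg.complexStructure_self]
  obtain ⟨a, b, rfl⟩ := Submodule.mem_span_pair.1 hv
  rw [hA, _root_.smul_apply, hV.nabla_complexStructure_leeField]
  simp only [antiLee, ← hV.isLeeField.apply_left hg x, map_add, map_smul, map_neg,
    _root_.add_apply, _root_.smul_apply, _root_.neg_apply, complexStructure_complexStructure,
    hg.hermitian, hBJB, smul_eq_mul]
  module

end IsVaisman

end Vaisman

section Tangency

variable {E : Type*} [NormedAddCommGroup E] [NormedSpace ℂ E]
  {M : Type*} [TopologicalSpace M] [ChartedSpace E M] [IsManifold 𝓘(ℂ, E) ω M]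
  {g : Π x : M, TangentSpace 𝓘(ℝ, E) x →L[ℝ] TangentSpace 𝓘(ℝ, E) x →L[ℝ] ℝ} {ν : ℕ}
  {lee : Π x : M, TangentSpace 𝓘(ℝ, E) x →L[ℝ] ℝ}
  {nabla : (Π x : M, TangentSpace 𝓘(ℝ, E) x) →
      (Π x : M, TangentSpace 𝓘(ℝ, E) x →L[ℝ] TangentSpace 𝓘(ℝ, E) x)}
  {B : Π x : M, TangentSpace 𝓘(ℝ, E) x} {x : M}

theorem IsDiffAt.antiLee (hB : IsDiffAt B x) : IsDiffAt (antiLee B) x :=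
  mdifferentiableAt_neg_section hB.complexStructure

-- Pairing `B` and `Y ∈ ℂ B` with `w` and `Jw` gives two complex numbers, whose quotient is the
-- complex coefficient of `Y`; here its denominator is cleared.
theorem IsHermitianMetric.smul_eq_of_mem_leePlane (hg : IsHermitianMetric g ν)
    (w : TangentSpace 𝓘(ℝ, E) x) {y : TangentSpace 𝓘(ℝ, E) x} (hy : y ∈ leePlane B x) :
    (g x w (antiLee B x) * g x w (antiLee B x) + g x w (B x) * g x w (B x)) • y =
      (g x w y * g x w (antiLee B x) - g x (complexStructure x w) y * g x w (B x)) • antiLee B x +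
      (g x w y * g x w (B x) + g x (complexStructure x w) y * g x w (antiLee B x)) • B x := by
  obtain ⟨k, l, rfl⟩ := Submodule.mem_span_pair.1 hy
  have hJA : g x (complexStructure x w) (antiLee B x) = -g x w (B x) := by
    rw [antiLee, map_neg, hg.hermitian]
  have hJB : g x (complexStructure x w) (B x) = g x w (antiLee B x) := by
    rw [hg.complexStructure_left, antiLee, map_neg]
  simp only [map_add, map_smul, smul_eq_mul, hJA, hJB]
  module

theorem IsHermitianMetric.exists_mdifferentiableAt_coeff_leePlane (hg : IsHermitianMetric g ν)
    (hB : IsDiffAt B x) (hBx : B x ≠ 0) {Y : Π x : M, TangentSpace 𝓘(ℝ, E) x}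
    (hY : IsDiffAt Y x) :
    ∃ a b : M → ℝ, MDifferentiableAt 𝓘(ℝ, E) 𝓘(ℝ, ℝ) a x ∧
      MDifferentiableAt 𝓘(ℝ, E) 𝓘(ℝ, ℝ) b x ∧
      ∀ᶠ y in 𝓝 x, Y y ∈ leePlane B y → Y y = a y • antiLee B y + b y • B y := by
  obtain ⟨w, hw⟩ : ∃ w, g x (B x) w ≠ 0 := by
    by_contra! h
    exact hBx (hg.nondegenerate x _ h)
  obtain ⟨W, hW, rfl⟩ := exists_isSmoothAt x w
  replace hW := hW.isDiffAt
  let α : M → ℝ := fun y => g y (W y) (antiLee B y)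
  let β : M → ℝ := fun y => g y (W y) (B y)
  let s : M → ℝ := fun y => g y (W y) (Y y)
  let t : M → ℝ := fun y => g y (complexStructure y (W y)) (Y y)
  have hα : MDifferentiableAt 𝓘(ℝ, E) 𝓘(ℝ, ℝ) α x := hW.metric hg hB.antiLee
  have hβ : MDifferentiableAt 𝓘(ℝ, E) 𝓘(ℝ, ℝ) β x := hW.metric hg hB
  have hs : MDifferentiableAt 𝓘(ℝ, E) 𝓘(ℝ, ℝ) s x := hW.metric hg hY
  have ht : MDifferentiableAt 𝓘(ℝ, E) 𝓘(ℝ, ℝ) t x := hW.complexStructure.metric hg hY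
  let D : M → ℝ := α * α + β * β
  have hD : MDifferentiableAt 𝓘(ℝ, E) 𝓘(ℝ, ℝ) D x := (hα.mul hα).add (hβ.mul hβ)
  have hβx : β x ≠ 0 := by rwa [hg.symm] at hw
  have hDx : D x ≠ 0 := (add_pos_of_nonneg_of_pos (mul_self_nonneg _) (mul_self_pos.2 hβx)).ne'
  refine ⟨(s * α - t * β) / D, (s * β + t * α) / D, ((hs.mul hα).sub (ht.mul hβ)).div hD hDx,
    ((hs.mul hβ).add (ht.mul hα)).div hD hDx, ?_⟩
  filter_upwards [hD.continuousAt.eventually_ne hDx] with y hDy hYy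
  have hDY : D y • Y y = (s y * α y - t y * β y) • antiLee B y + (s y * β y + t y * α y) • B y :=
    hg.smul_eq_of_mem_leePlane (W y) hYy
  simp only [Pi.div_apply, Pi.add_apply, Pi.sub_apply, Pi.mul_apply]
  rw [div_eq_inv_mul, div_eq_inv_mul, mul_smul, mul_smul, ← smul_add, ← hDY, inv_smul_smul₀ hDy]

theorem IsVaisman.nabla_mem_leePlane [FiniteDimensional ℂ E] (hV : IsVaisman g ν lee nabla B)
    {F H N : Type*} [NormedAddCommGroup F] [NormedSpace ℝ F] [TopologicalSpace H]
    {I : ModelWithCorners ℝ F H} [TopologicalSpace N] [ChartedSpace H N] {j : N → M} {p : N}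
    (hj : MDifferentiableAt I 𝓘(ℝ, E) j p) {v : TangentSpace I p}
    (hv : mfderiv I 𝓘(ℝ, E) j p v ∈ leePlane B (j p)) (hBp : B (j p) ≠ 0)
    {Y : Π x : M, TangentSpace 𝓘(ℝ, E) x} (hY : IsDiffAt Y (j p))
    (hYP : ∀ᶠ q in 𝓝 p, Y (j q) ∈ leePlane B (j q)) :
    nabla Y (j p) (mfderiv I 𝓘(ℝ, E) j p v) ∈ leePlane B (j p) := by
  have hB := (hV.isSmoothAt_leeField (j p)).isDiffAt
  have hcov := hV.isLeviCivitaOn.isCovariantDerivativeOn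
  obtain ⟨a, b, ha, hb, hab⟩ :=
    hV.isHermitianMetric.exists_mdifferentiableAt_coeff_leePlane hB hBp hY
  have haA : IsDiffAt (a • antiLee B) (j p) := ha.smul_section hB.antiLee
  have hbB : IsDiffAt (b • B) (j p) := hb.smul_section hB
  have hYeq : ∀ᶠ q in 𝓝 p, Y (j q) = (a • antiLee B + b • B) (j q) := by
    filter_upwards [hj.continuousAt.eventually hab, hYP] with q hq hYq using hq hYq
  rw [hV.isLeviCivitaOn.nabla_congr_of_comp_eventuallyEq hV.isHermitianMetric hj v hY
    (mdifferentiableAt_add_section haA hbB) hYeq, hcov.add haA hbB, hcov.leibniz hB.antiLee ha,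
    hcov.leibniz hB hb]
  simp only [_root_.add_apply, _root_.smul_apply, ContinuousLinearMap.smulRight_apply,
    hV.nabla_antiLee _ hv, hV.nabla_leeField, smul_zero, zero_add]
  exact add_mem (Submodule.smul_mem _ _ (antiLee_mem_leePlane _))
    (Submodule.smul_mem _ _ (leeField_mem_leePlane _))

end Tangency

/-! ### Holomorphic vector fields and foliated charts -/

section ChartRepresentation

variable {E : Type*} [NormedAddCommGroup E] [NormedSpace ℂ E]
  {M : Type*} [TopologicalSpace M] [ChartedSpace E M] [IsManifold 𝓘(ℂ, E) ω M]

/-- The vector field `X` read in the preferred chart at `x₀`, as a map on the model space. -/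
def chartRep (X : Π x : M, TangentSpace 𝓘(ℝ, E) x) (x₀ : M) (u : E) : E :=
  tangentCoordChange 𝓘(ℝ, E) ((chartAt E x₀).symm u) x₀ ((chartAt E x₀).symm u)
    (X ((chartAt E x₀).symm u))

/-- The vector field that the preferred chart at `x₀` sends to the constant `v`, a genuine vector
field on the chart domain only; brackets with it compute the derivative of `chartRep`. -/
def constField (x₀ : M) (v : E) (y : M) : TangentSpace 𝓘(ℝ, E) y :=
  tangentCoordChange 𝓘(ℝ, E) x₀ y y v

theorem tangentCoordChange_tangentCoordChange {x₀ y : M} (hy : y ∈ (chartAt E x₀).source) (v : E) :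
    tangentCoordChange 𝓘(ℝ, E) x₀ y y (tangentCoordChange 𝓘(ℝ, E) y x₀ y v) = v := by
  rw [tangentCoordChange_comp (by simpa using hy), tangentCoordChange_self (by simp)]

theorem tangentCoordChange_tangentCoordChange' {x₀ y : M} (hy : y ∈ (chartAt E x₀).source)
    (v : E) :
    tangentCoordChange 𝓘(ℝ, E) y x₀ y (tangentCoordChange 𝓘(ℝ, E) x₀ y y v) = v := by
  rw [tangentCoordChange_comp (by simpa using hy), tangentCoordChange_self (by simpa using hy)]

theorem contDiffOn_chartRep {X : Π x : M, TangentSpace 𝓘(ℝ, E) x} (x₀ : M)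
    (hX : ∀ x, IsSmoothAt X x) :
    ContDiffOn ℝ ∞ (chartRep X x₀) (chartAt E x₀).target := by
  rw [← contMDiffOn_iff_contDiffOn]
  intro u hu
  have hy := (chartAt E x₀).map_target hu
  have h1 := (isSmoothAt_iff hy).1 (hX _)
  have h2 : ContMDiffWithinAt 𝓘(ℝ, E) 𝓘(ℝ, E) ∞ (chartAt E x₀).symm (chartAt E x₀).target u :=
    contMDiffOn_chart_symm u hu
  exact h1.comp_contMDiffWithinAt u h2

theorem isSmoothAt_constField {x₀ y : M} (hy : y ∈ (chartAt E x₀).source) (v : E) :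
    IsSmoothAt (constField x₀ v) y := by
  rw [isSmoothAt_iff hy]
  refine (contMDiffAt_const (c := v)).congr_of_eventuallyEq ?_
  filter_upwards [(chartAt E x₀).open_source.mem_nhds hy] with z hz
  exact tangentCoordChange_tangentCoordChange' hz v

theorem mpullback_chartAt {x₀ y : M} (hy : y ∈ (chartAt E x₀).source)
    (F : Π u : E, TangentSpace 𝓘(ℝ, E) u) :
    VectorField.mpullback 𝓘(ℝ, E) 𝓘(ℝ, E) (chartAt E x₀) F y =
      tangentCoordChange 𝓘(ℝ, E) x₀ y y (F (chartAt E x₀ y)) := by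
  have : (tangentCoordChange 𝓘(ℝ, E) y x₀ y).inverse = tangentCoordChange 𝓘(ℝ, E) x₀ y y := by
    apply ContinuousLinearMap.inverse_eq
    · ext v
      exact tangentCoordChange_tangentCoordChange' hy v
    · ext v
      exact tangentCoordChange_tangentCoordChange hy v
  rw [VectorField.mpullback_apply, mfderiv_chartAt_eq_tangentCoordChange hy]
  exact congrArg (fun T : E →L[ℝ] E => T (F (chartAt E x₀ y))) this

theorem chartRep_chartAt (X : Π x : M, TangentSpace 𝓘(ℝ, E) x) {x₀ y : M}
    (hy : y ∈ (chartAt E x₀).source) :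
    chartRep X x₀ (chartAt E x₀ y) = tangentCoordChange 𝓘(ℝ, E) y x₀ y (X y) := by
  rw [chartRep, (chartAt E x₀).left_inv hy]

theorem mpullback_chartAt_chartRep (X : Π x : M, TangentSpace 𝓘(ℝ, E) x) {x₀ y : M}
    (hy : y ∈ (chartAt E x₀).source) :
    VectorField.mpullback 𝓘(ℝ, E) 𝓘(ℝ, E) (chartAt E x₀)
      (chartRep X x₀ : Π u : E, TangentSpace 𝓘(ℝ, E) u) y = X y :=
  (mpullback_chartAt hy _).trans <|
    (congrArg (tangentCoordChange 𝓘(ℝ, E) x₀ y y) (chartRep_chartAt X hy)).trans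
      (tangentCoordChange_tangentCoordChange hy (X y))

theorem mlieBracket_constField [CompleteSpace E] {X : Π x : M, TangentSpace 𝓘(ℝ, E) x} {x₀ y : M}
    (hX : ∀ x, IsSmoothAt X x) (hy : y ∈ (chartAt E x₀).source) (v : E) :
    VectorField.mlieBracket 𝓘(ℝ, E) X (constField x₀ v) y =
      -tangentCoordChange 𝓘(ℝ, E) x₀ y y (fderiv ℝ (chartRep X x₀) (chartAt E x₀ y) v) := by
  let F : Π u : E, TangentSpace 𝓘(ℝ, E) u := chartRep X x₀
  let G : Π u : E, TangentSpace 𝓘(ℝ, E) u := fun _ => v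
  have hU := (chartAt E x₀).open_source.mem_nhds hy
  have hXF : X =ᶠ[𝓝 y] VectorField.mpullback 𝓘(ℝ, E) 𝓘(ℝ, E) (chartAt E x₀) F := by
    filter_upwards [hU] with z hz using (mpullback_chartAt_chartRep X hz).symm
  have hvG : constField x₀ v =ᶠ[𝓝 y] VectorField.mpullback 𝓘(ℝ, E) 𝓘(ℝ, E) (chartAt E x₀) G := by
    filter_upwards [hU] with z hz using (mpullback_chartAt hz G).symm
  have hF : ContDiffAt ℝ ∞ F (chartAt E x₀ y) :=
    (contDiffOn_chartRep x₀ hX).contDiffAt ((chartAt E x₀).open_target.mem_nhds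
      ((chartAt E x₀).map_source hy))
  have hbracket : VectorField.mlieBracket 𝓘(ℝ, E) F G (chartAt E x₀ y) =
      -fderiv ℝ (chartRep X x₀) (chartAt E x₀ y) v := by
    rw [← VectorField.mlieBracketWithin_univ, VectorField.mlieBracketWithin_eq_lieBracketWithin,
      VectorField.lieBracketWithin_univ, VectorField.lieBracket,
      show fderiv ℝ G (chartAt E x₀ y) = 0 from fderiv_const_apply v]
    exact zero_sub _
  have : IsManifold 𝓘(ℝ, E) (minSmoothness ℝ 3) M := .of_le (n := ω) le_top
  have hpull := VectorField.mpullback_mlieBracket (I := 𝓘(ℝ, E)) (I' := 𝓘(ℝ, E)) (n := ω)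
    (f := chartAt E x₀) (x₀ := y) (V := F) (W := G)
    ((contMDiffAt_vectorSpace_iff_contDiffAt.2 hF).mdifferentiableAt (by simp : (∞ : ℕ∞ω) ≠ 0))
    ((contMDiffAt_vectorSpace_iff_contDiffAt (V := G) (n := ∞)).2 contDiffAt_const
      |>.mdifferentiableAt (by simp))
    (contMDiffOn_chart.contMDiffAt hU) le_top
  rw [hXF.mlieBracket_vectorField_eq hvG, ← hpull, mpullback_chartAt hy, hbracket]
  exact map_neg _ _

end ChartRepresentation

section LeePlaneImage

variable {E : Type*} [NormedAddCommGroup E] [NormedSpace ℂ E]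
  {M : Type*} [TopologicalSpace M] [ChartedSpace E M] {B : Π x : M, TangentSpace 𝓘(ℝ, E) x}

theorem map_leePlane {x : M} {T : TangentSpace 𝓘(ℝ, E) x →L[ℝ] E}
    (hT : ∀ v, T (complexStructure x v) = Complex.I • T v) {b : E} (hb : T (B x) = b) :
    (leePlane B x).map (T : TangentSpace 𝓘(ℝ, E) x →ₗ[ℝ] E) =
      Submodule.span ℝ {-(Complex.I • b), b} := by
  simp [leePlane, Submodule.map_span, Set.image_pair, antiLee, hT, hb]

theorem finrank_span_neg_I_smul {b : E} (hb : b ≠ 0) :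
    Module.finrank ℝ (Submodule.span ℝ {-(Complex.I • b), b}) = 2 :=
  finrank_leePlane (M := E) (B := fun _ => b) (x := b) hb

end LeePlaneImage

section FoliatedChart

theorem trans_mem_maximalAtlas {𝕜 : Type*} [NontriviallyNormedField 𝕜] {E : Type*}
    [NormedAddCommGroup E] [NormedSpace 𝕜 E] {M : Type*} [TopologicalSpace M] [ChartedSpace E M]
    {n : ℕ∞ω} [IsManifold 𝓘(𝕜, E) n M] {φ : OpenPartialHomeomorph M E}
    (hφ : φ ∈ IsManifold.maximalAtlas 𝓘(𝕜, E) n M) {e : OpenPartialHomeomorph E E}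
    (he : ContDiffOn 𝕜 n e e.source) (he' : ContDiffOn 𝕜 n e.symm e.target) :
    φ.trans e ∈ IsManifold.maximalAtlas 𝓘(𝕜, E) n M := by
  refine (φ.trans e).mem_maximalAtlas_of_contMDiffOn ?_ ?_
  · rw [φ.trans_source]
    exact he.contMDiffOn.comp ((contMDiffOn_of_mem_maximalAtlas hφ).mono Set.inter_subset_left)
      Set.inter_subset_right
  · rw [φ.trans_target]
    exact (contMDiffOn_symm_of_mem_maximalAtlas hφ).comp
      (he'.contMDiffOn.mono Set.inter_subset_left) Set.inter_subset_right

variable {E : Type u} [NormedAddCommGroup E] [NormedSpace ℂ E]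
  {M : Type*} [TopologicalSpace M] [ChartedSpace E M] [IsManifold 𝓘(ℂ, E) ω M]
  {g : Π x : M, TangentSpace 𝓘(ℝ, E) x →L[ℝ] TangentSpace 𝓘(ℝ, E) x →L[ℝ] ℝ} {ν : ℕ}
  {lee : Π x : M, TangentSpace 𝓘(ℝ, E) x →L[ℝ] ℝ}
  {nabla : (Π x : M, TangentSpace 𝓘(ℝ, E) x) →
      (Π x : M, TangentSpace 𝓘(ℝ, E) x →L[ℝ] TangentSpace 𝓘(ℝ, E) x)}
  {B : Π x : M, TangentSpace 𝓘(ℝ, E) x}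

theorem mfderiv_chartAt_trans_apply {x₀ y : M} {e : OpenPartialHomeomorph E E}
    (hy : y ∈ (chartAt E x₀).source) (he : DifferentiableAt ℂ e (chartAt E x₀ y))
    (v : TangentSpace 𝓘(ℝ, E) y) :
    (mfderiv 𝓘(ℝ, E) 𝓘(ℝ, E) ((chartAt E x₀).trans e) y v : E) =
      fderiv ℂ e (chartAt E x₀ y) (tangentCoordChange 𝓘(ℝ, E) y x₀ y v) := by
  have hchart : HasMFDerivAt 𝓘(ℝ, E) 𝓘(ℝ, E) (chartAt E x₀) y
      (tangentCoordChange 𝓘(ℝ, E) y x₀ y) := by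
    rw [← mfderiv_chartAt_eq_tangentCoordChange hy]
    exact (mdifferentiableAt_atlas (ChartedSpace.chart_mem_atlas x₀) hy).hasMFDerivAt
  have hcomp := ((he.hasFDerivAt.restrictScalars ℝ).hasMFDerivAt).comp y hchart
  exact congrArg (fun T : E →L[ℝ] E => T v) hcomp.mfderiv

theorem exists_chart_mfderiv_eq_const [CompleteSpace E] {X : Π x : M, TangentSpace 𝓘(ℝ, E) x}
    {x₀ : M} (hX : ContDiffOn ℂ ∞ (chartRep X x₀) (chartAt E x₀).target) (hx₀ : X x₀ ≠ 0) :
    ∃ φ ∈ IsManifold.maximalAtlas 𝓘(ℝ, E) ∞ M, x₀ ∈ φ.source ∧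
      ∀ y ∈ φ.source, (mfderiv 𝓘(ℝ, E) 𝓘(ℝ, E) φ y (X y) : E) = X x₀ ∧
        ∀ v, mfderiv 𝓘(ℝ, E) 𝓘(ℝ, E) φ y (complexStructure y v) =
          complexStructure (φ y) (mfderiv 𝓘(ℝ, E) 𝓘(ℝ, E) φ y v) := by
  have hmem : x₀ ∈ (chartAt E x₀).source := mem_chart_source E x₀
  have hXx₀ : chartRep X x₀ (chartAt E x₀ x₀) = X x₀ :=
    (chartRep_chartAt X hmem).trans (tangentCoordChange_self (by simp))
  obtain ⟨e, hxe, -, he, he', hder⟩ := exists_straightening (chartAt E x₀).open_target hX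
    ((chartAt E x₀).map_source hmem) (fun h => hx₀ (hXx₀.symm.trans h))
  refine ⟨(chartAt E x₀).trans e, trans_mem_maximalAtlas (IsManifold.chart_mem_maximalAtlas x₀)
    (he.restrict_scalars ℝ) (he'.restrict_scalars ℝ), ?_, ?_⟩
  · rw [OpenPartialHomeomorph.trans_source]
    exact ⟨hmem, hxe⟩
  · intro y hy
    rw [OpenPartialHomeomorph.trans_source] at hy
    have hey : DifferentiableAt ℂ e (chartAt E x₀ y) :=
      (he.contDiffAt (e.open_source.mem_nhds hy.2)).differentiableAt (by simp)
    refine ⟨?_, fun v => ?_⟩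
    · rw [mfderiv_chartAt_trans_apply hy.1 hey, ← chartRep_chartAt X hy.1, hder _ hy.2, hXx₀]
    · refine (mfderiv_chartAt_trans_apply hy.1 hey _).trans ?_
      rw [tangentCoordChange_complexStructure hy.1, map_smul,
        ← mfderiv_chartAt_trans_apply hy.1 hey]
      rfl

theorem IsVaisman.mlieBracket_leeField_complexStructure [FiniteDimensional ℂ E]
    (hV : IsVaisman g ν lee nabla B) {X : Π x : M, TangentSpace 𝓘(ℝ, E) x} {x : M}
    (hX : IsDiffAt X x) :
    VectorField.mlieBracket 𝓘(ℝ, E) B (fun y => complexStructure y (X y)) x =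
      complexStructure x (VectorField.mlieBracket 𝓘(ℝ, E) B X x) := by
  have hB := (hV.isSmoothAt_leeField x).isDiffAt
  have hJ := hV.isLocallyConformalKahler.weylConnection_complexStructure hV.isHermitianMetric
    hV.isLeviCivitaOn hV.isLeeField hX (B x)
  simp only [weylConnection_apply, hV.isLeeField _ _, map_sub, map_add, map_smul] at hJ
  rw [← hV.isLeviCivitaOn.torsionFree x trivial B _ hB hX.complexStructure,
    ← hV.isLeviCivitaOn.torsionFree x trivial B _ hB hX, hV.nabla_leeField,
    eq_add_of_sub_eq hJ]
  simp only [_root_.zero_apply, sub_zero]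
  module

theorem IsVaisman.fderiv_chartRep_leeField_I_smul [FiniteDimensional ℂ E]
    (hV : IsVaisman g ν lee nabla B) (x₀ : M) {u : E} (hu : u ∈ (chartAt E x₀).target) (v : E) :
    fderiv ℝ (chartRep B x₀) u (Complex.I • v) = Complex.I • fderiv ℝ (chartRep B x₀) u v := by
  have : CompleteSpace E := FiniteDimensional.complete ℂ E
  let y := (chartAt E x₀).symm u
  have hy : y ∈ (chartAt E x₀).source := (chartAt E x₀).map_target hu
  have hyu : chartAt E x₀ y = u := (chartAt E x₀).right_inv hu
  have hfderiv (w : E) : fderiv ℝ (chartRep B x₀) u w = tangentCoordChange 𝓘(ℝ, E) y x₀ y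
      (-VectorField.mlieBracket 𝓘(ℝ, E) B (constField x₀ w) y) := by
    rw [mlieBracket_constField hV.isSmoothAt_leeField hy, hyu]
    exact (tangentCoordChange_tangentCoordChange' hy _).symm.trans
      (congrArg (tangentCoordChange 𝓘(ℝ, E) y x₀ y) (neg_neg _).symm)
  have hconst : constField x₀ (Complex.I • v) =ᶠ[𝓝 y]
      fun z => complexStructure z (constField x₀ v z) := by
    filter_upwards [(chartAt E x₀).open_source.mem_nhds hy] with z hz
    exact tangentCoordChange_I_smul hz (mem_chart_source E z) v
  rw [hfderiv, hfderiv, Filter.EventuallyEq.rfl.mlieBracket_vectorField_eq hconst,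
    hV.mlieBracket_leeField_complexStructure (isSmoothAt_constField hy v).isDiffAt, ← map_neg]
  exact tangentCoordChange_complexStructure hy _

theorem IsVaisman.isTangentToFoliationOn_leePlane [FiniteDimensional ℂ E]
    (hV : IsVaisman g ν lee nabla B) : IsTangentToFoliationOn (leePlane B) 2 (Sing B)ᶜ := by
  have : CompleteSpace E := FiniteDimensional.complete ℂ E
  intro x₀ hx₀
  have hhol : ContDiffOn ℂ ∞ (chartRep B x₀) (chartAt E x₀).target :=
    contDiffOn_complex (chartAt E x₀).open_target (contDiffOn_chartRep x₀ hV.isSmoothAt_leeField)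
      fun _ hu => hV.fderiv_chartRep_leeField_I_smul x₀ hu
  obtain ⟨φ, hφ, hx₀φ, hder⟩ := exists_chart_mfderiv_eq_const hhol hx₀
  refine ⟨φ, hφ, hx₀φ, ?_, _, finrank_span_neg_I_smul (E := E) (b := B x₀) hx₀, ?_⟩
  · intro y hy hBy
    refine hx₀ ((hder y hy).1.symm.trans ?_)
    rw [show B y = 0 from hBy]
    exact map_zero _
  · intro y hy v
    have hφd : φ.MDifferentiable 𝓘(ℝ, E) 𝓘(ℝ, E) :=
      ⟨(contMDiffOn_of_mem_maximalAtlas hφ).mdifferentiableOn (by simp),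
        (contMDiffOn_symm_of_mem_maximalAtlas hφ).mdifferentiableOn (by simp)⟩
    have hmap := map_leePlane (hder y hy).2 (hder y hy).1
    rw [← hmap]
    exact (Function.Injective.mem_set_image (hφd.mfderiv_injective hy)).symm

end FoliatedChart

/-! ### Bilinear forms -/

section BilinForm

variable {K V : Type*} [Field K] [AddCommGroup V] [Module K V] [FiniteDimensional K V]
  {b : LinearMap.BilinForm K V}

theorem orthogonal_sup_orthogonal_of_disjoint (hb : b.Nondegenerate) (hrefl : b.IsRefl)
    {T S : Submodule K V} (hTS : Disjoint T S) : b.orthogonal T ⊔ b.orthogonal S = ⊤ := by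
  have hbot : b.orthogonal (b.orthogonal T ⊔ b.orthogonal S) = ⊥ := by
    rw [eq_bot_iff, ← hTS.eq_bot, le_inf_iff]
    constructor
    · exact (LinearMap.BilinForm.orthogonal_le le_sup_left).trans
        (LinearMap.BilinForm.orthogonal_orthogonal hb hrefl T).le
    · exact (LinearMap.BilinForm.orthogonal_le le_sup_right).trans
        (LinearMap.BilinForm.orthogonal_orthogonal hb hrefl S).le
  rw [← LinearMap.BilinForm.orthogonal_orthogonal hb hrefl (b.orthogonal T ⊔ _), hbot,
    LinearMap.BilinForm.orthogonal_bot]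

theorem isCompl_sup_of_isTotallyNull (hb : b.Nondegenerate) (hrefl : b.IsRefl)
    {T S l : Submodule K V} (hT : T ≤ b.orthogonal T) (hTS : Disjoint T S)
    (hTS' : T ⊔ S = b.orthogonal T) (hTl : T ⊔ l = b.orthogonal S)
    (hl : ∀ v ∈ l, ∀ w ∈ l, b v w = 0) : IsCompl (l ⊔ S) T := by
  constructor
  · rw [Submodule.disjoint_def]
    intro x hx hxT
    obtain ⟨y, hy, s, hs, rfl⟩ := Submodule.mem_sup.1 hx
    have hsT : s ∈ b.orthogonal T := hTS' ▸ Submodule.mem_sup_right hs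
    have hyT : y ∈ b.orthogonal T := (Submodule.add_mem_iff_left _ hsT).1 (hT hxT)
    have hyS : y ∈ b.orthogonal (b.orthogonal S) := by
      rw [← hTl]
      intro w hw
      obtain ⟨t, ht, z, hz, rfl⟩ := Submodule.mem_sup.1 hw
      rw [LinearMap.BilinForm.add_left, show b t y = 0 from hyT t ht, hl z hz y hy, add_zero]
    rw [LinearMap.BilinForm.orthogonal_orthogonal hb hrefl] at hyS
    exact Submodule.disjoint_def.1 hTS _ hxT (S.add_mem hyS hs)
  · rw [codisjoint_iff, ← orthogonal_sup_orthogonal_of_disjoint hb hrefl hTS, ← hTS', ← hTl,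
      sup_comm (l ⊔ S) T, sup_comm l S, ← sup_assoc, sup_sup_sup_comm, sup_idem, sup_assoc]

end BilinForm

section LeePlaneMetric

variable {E : Type*} [NormedAddCommGroup E] [NormedSpace ℂ E]
  {M : Type*} [TopologicalSpace M] [ChartedSpace E M]
  {g : Π x : M, TangentSpace 𝓘(ℝ, E) x →L[ℝ] TangentSpace 𝓘(ℝ, E) x →L[ℝ] ℝ} {ν : ℕ}
  {B : Π x : M, TangentSpace 𝓘(ℝ, E) x} {x : M}

theorem sing_eq_empty (hB : ∀ x, g x (B x) (B x) ≠ 0) : Sing B = ∅ :=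
  Set.eq_empty_of_forall_notMem fun x hx => hB x (by rw [show B x = 0 from hx, map_zero])

variable [IsManifold 𝓘(ℂ, E) ω M]

namespace IsHermitianMetric

theorem isRefl_form (hg : IsHermitianMetric g ν) (x : M) : (form g x).IsRefl :=
  fun v w h => (hg.symm x w v).trans h

theorem nondegenerate_form (hg : IsHermitianMetric g ν) (x : M) : (form g x).Nondegenerate :=
  ⟨fun v h => hg.nondegenerate x v h,
    fun v h => hg.nondegenerate x v fun w => (hg.symm x v w).trans (h w)⟩

theorem apply_smul_antiLee_add_smul (hg : IsHermitianMetric g ν) (x : M) (k l k' l' : ℝ) :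
    g x (k • antiLee B x + l • B x) (k' • antiLee B x + l' • B x) =
      (k * k' + l * l') * g x (B x) (B x) := by
  have hAA : g x (antiLee B x) (antiLee B x) = g x (B x) (B x) := by
    simp [antiLee, hg.hermitian]
  have hAB : g x (antiLee B x) (B x) = 0 := by
    simpa [antiLee] using hg.complexStructure_self x (B x)
  have hBA : g x (B x) (antiLee B x) = 0 := by rw [hg.symm, hAB]
  simp only [map_add, map_smul, _root_.add_apply, _root_.smul_apply, smul_eq_mul, hAA, hAB, hBA]
  ring

theorem leePlane_le_perp (hg : IsHermitianMetric g ν) (hB : g x (B x) (B x) = 0) :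
    leePlane B x ≤ perp g x (leePlane B x) := by
  intro v hv w hw
  obtain ⟨k, l, rfl⟩ := Submodule.mem_span_pair.1 hv
  obtain ⟨k', l', rfl⟩ := Submodule.mem_span_pair.1 hw
  exact (hg.apply_smul_antiLee_add_smul x k' l' k l).trans (by rw [hB, mul_zero])

theorem sign_mul_pos_of_mem_leePlane (hg : IsHermitianMetric g ν) (hB : g x (B x) (B x) ≠ 0)
    {v : TangentSpace 𝓘(ℝ, E) x} (hv : v ∈ leePlane B x) (hv0 : v ≠ 0) :
    0 < Real.sign (g x (B x) (B x)) * g x v v := by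
  obtain ⟨k, l, rfl⟩ := Submodule.mem_span_pair.1 hv
  have hkl : 0 < k * k + l * l := by
    refine (add_nonneg (mul_self_nonneg k) (mul_self_nonneg l)).lt_of_ne' fun h => hv0 ?_
    obtain ⟨rfl, rfl⟩ := mul_self_add_mul_self_eq_zero.1 h
    rw [zero_smul, zero_smul, zero_add]
  rw [hg.apply_smul_antiLee_add_smul, mul_left_comm]
  exact mul_pos hkl (Real.sign_mul_pos_of_ne_zero _ hB)

theorem disjoint_leePlane_perp (hg : IsHermitianMetric g ν) (hB : g x (B x) (B x) ≠ 0) :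
    Disjoint (leePlane B x) (perp g x (leePlane B x)) := by
  rw [Submodule.disjoint_def]
  intro v hv hv'
  by_contra hv0
  have hpos := hg.sign_mul_pos_of_mem_leePlane hB hv hv0
  rw [show g x v v = 0 from hv' v hv, mul_zero] at hpos
  exact lt_irrefl _ hpos

theorem isCompl_perp_leePlane [FiniteDimensional ℂ E] (hg : IsHermitianMetric g ν)
    (hB : g x (B x) (B x) ≠ 0) : IsCompl (perp g x (leePlane B x)) (leePlane B x) := by
  have : FiniteDimensional ℝ (TangentSpace 𝓘(ℝ, E) x) := FiniteDimensional.complexToReal E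
  exact ((LinearMap.BilinForm.isCompl_orthogonal_iff_disjoint (hg.isRefl_form x)).2
    (hg.disjoint_leePlane_perp hB)).symm

end IsHermitianMetric

end LeePlaneMetric

/-! ### The Lee distribution -/

theorem isLocallyConstant_of_hasMFDerivAt_zero {E F M : Type*} [NormedAddCommGroup E]
    [NormedSpace ℝ E] [NormedAddCommGroup F] [NormedSpace ℝ F] [TopologicalSpace M]
    [ChartedSpace E M] [IsManifold 𝓘(ℝ, E) 1 M] {f : M → F}
    (hf : ∀ x, HasMFDerivAt 𝓘(ℝ, E) 𝓘(ℝ, F) f x 0) : IsLocallyConstant f := by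
  intro t
  rw [isOpen_iff_mem_nhds]
  intro x hx
  let φ := chartAt E x
  have hxφ : x ∈ φ.source := mem_chart_source E x
  have hderiv (u : E) (hu : u ∈ φ.target) : HasFDerivAt (f ∘ φ.symm) (0 : E →L[ℝ] F) u := by
    have hsymm := mdifferentiableAt_atlas_symm (I := 𝓘(ℝ, E)) (ChartedSpace.chart_mem_atlas x) hu
    exact ((hf (φ.symm u)).comp u hsymm.hasMFDerivAt).hasFDerivAt.congr_fderiv
      (ContinuousLinearMap.zero_comp _)
  have hopen : IsOpen (φ.target ∩ f ∘ φ.symm ⁻¹' t) :=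
    φ.open_target.isOpen_inter_preimage_of_fderiv_eq_zero
      (fun u hu => (hderiv u hu).differentiableAt.differentiableWithinAt)
      (fun u hu => (hderiv u hu).fderiv) t
  have hmem : φ x ∈ φ.target ∩ f ∘ φ.symm ⁻¹' t :=
    ⟨φ.map_source hxφ, by rwa [Set.mem_preimage, Function.comp_apply, φ.left_inv hxφ]⟩
  filter_upwards [φ.open_source.mem_nhds hxφ,
    (φ.continuousAt hxφ).preimage_mem_nhds (hopen.mem_nhds hmem)] with y hy hyt
  simpa [φ.left_inv hy] using hyt.2

section LeeDistribution

variable {E : Type*} [NormedAddCommGroup E] [NormedSpace ℂ E]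
  {M : Type*} [TopologicalSpace M] [ChartedSpace E M] [IsManifold 𝓘(ℂ, E) ω M]
  {g : Π x : M, TangentSpace 𝓘(ℝ, E) x →L[ℝ] TangentSpace 𝓘(ℝ, E) x →L[ℝ] ℝ} {ν : ℕ}
  {lee : Π x : M, TangentSpace 𝓘(ℝ, E) x →L[ℝ] ℝ}
  {nabla : (Π x : M, TangentSpace 𝓘(ℝ, E) x) →
      (Π x : M, TangentSpace 𝓘(ℝ, E) x →L[ℝ] TangentSpace 𝓘(ℝ, E) x)}
  {B : Π x : M, TangentSpace 𝓘(ℝ, E) x}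

theorem isOpen_compl_sing (hB : ∀ x, IsSmoothAt B x) : IsOpen (Sing B)ᶜ := by
  rw [isOpen_iff_mem_nhds]
  intro x hx
  have hcont := ((isSmoothAt_iff (mem_chart_source E x)).1 (hB x)).continuousAt
  have hne : tangentCoordChange 𝓘(ℝ, E) x x x (B x) ≠ 0 := fun h =>
    hx ((tangentCoordChange_self (v := show E from B x) (by simp)).symm.trans h)
  filter_upwards [hcont.eventually_ne hne] with y hy hBy
  refine hy ?_
  rw [show B y = 0 from hBy]
  exact map_zero _

theorem isSmoothDistributionOn_leePlane (hB : ∀ x, IsSmoothAt B x) :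
    IsSmoothDistributionOn (leePlane B) 2 (Sing B)ᶜ := by
  intro x hx
  refine ⟨(Sing B)ᶜ, (isOpen_compl_sing hB).mem_nhds hx, ![antiLee B, B], ?_, fun y hy => ?_⟩
  · rw [Fin.forall_fin_two]
    exact ⟨fun y _ => (hB y).antiLee.contMDiffWithinAt, fun y _ => (hB y).contMDiffWithinAt⟩
  · have hframe : (fun j => (![antiLee B, B] : Fin 2 → Π z : M, TangentSpace 𝓘(ℝ, E) z) j y) =
        ![antiLee B y, B y] := by
      ext j
      fin_cases j <;> rfl
    rw [hframe]
    exact ⟨linearIndependent_antiLee hy, leePlane_eq_span_range y⟩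

variable [FiniteDimensional ℂ E]

namespace IsVaisman

theorem isLocallyConstant_leeField_sq (hV : IsVaisman g ν lee nabla B) :
    IsLocallyConstant fun x => g x (B x) (B x) := by
  have : IsManifold 𝓘(ℝ, E) 1 M := .of_le (n := ω) le_top
  refine isLocallyConstant_of_hasMFDerivAt_zero (E := E) fun x => ?_
  have hB := (hV.isSmoothAt_leeField x).isDiffAt
  have hsq := (hB.metric hV.isHermitianMetric hB).hasMFDerivAt
  rwa [show mfderiv 𝓘(ℝ, E) 𝓘(ℝ, ℝ) (fun y => g y (B y) (B y)) x = 0 from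
    hV.mvfderiv_leeField_sq x] at hsq

theorem isInvolutiveOn_leePlane (hV : IsVaisman g ν lee nabla B) :
    IsInvolutiveOn (leePlane B) (Sing B)ᶜ := by
  intro V hVo hVS X Y hX hY hXY y hy
  have hVy := hVo.mem_nhds hy
  have hXd : IsDiffAt X y := IsSmoothAt.isDiffAt (hX.contMDiffAt hVy)
  have hYd : IsDiffAt Y y := IsSmoothAt.isDiffAt (hY.contMDiffAt hVy)
  have nabla_mem {Z W : Π x : M, TangentSpace 𝓘(ℝ, E) x} (hZ : IsDiffAt Z y)
      (hZP : ∀ z ∈ V, Z z ∈ leePlane B z) (hW : W y ∈ leePlane B y) :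
      nabla Z y (W y) ∈ leePlane B y := by
    have h := hV.nabla_mem_leePlane (I := 𝓘(ℝ, E)) (j := (id : M → M)) (v := W y)
      mdifferentiableAt_id (by rwa [mfderiv_id]) (hVS hy) hZ (Filter.mem_of_superset hVy hZP)
    rwa [mfderiv_id] at h
  rw [← hV.isLeviCivitaOn.torsionFree y trivial X Y hXd hYd]
  exact Submodule.sub_mem _ (nabla_mem hYd (fun z hz => (hXY z hz).2) (hXY y hy).1)
    (nabla_mem hXd (fun z hz => (hXY z hz).1) (hXY y hy).2)

end IsVaisman

end LeeDistribution

/-! ### Integral surfaces -/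

section Surface

variable {E : Type*} [NormedAddCommGroup E] [NormedSpace ℂ E]
  {M : Type*} [TopologicalSpace M] [ChartedSpace E M] [IsManifold 𝓘(ℂ, E) ω M]
  {g : Π x : M, TangentSpace 𝓘(ℝ, E) x →L[ℝ] TangentSpace 𝓘(ℝ, E) x →L[ℝ] ℝ} {ν : ℕ}
  {lee : Π x : M, TangentSpace 𝓘(ℝ, E) x →L[ℝ] ℝ}
  {nabla : (Π x : M, TangentSpace 𝓘(ℝ, E) x) →
      (Π x : M, TangentSpace 𝓘(ℝ, E) x →L[ℝ] TangentSpace 𝓘(ℝ, E) x)}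
  {B : Π x : M, TangentSpace 𝓘(ℝ, E) x}
  {L : Type*} [TopologicalSpace L] [ChartedSpace (EuclideanSpace ℝ (Fin 2)) L] {i : L → M}
  {U : Set M} {P : Π x : M, Submodule ℝ (TangentSpace 𝓘(ℝ, E) x)}

namespace IsIntegralSurface

theorem mdifferentiableAt (hi : IsIntegralSurface P U i) (p : L) :
    MDifferentiableAt 𝓘(ℝ, EuclideanSpace ℝ (Fin 2)) 𝓘(ℝ, E) i p :=
  hi.contMDiff.mdifferentiable (by simp) p

theorem mfderiv_mem (hi : IsIntegralSurface P U i) (p : L)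
    (v : TangentSpace 𝓘(ℝ, EuclideanSpace ℝ (Fin 2)) p) :
    mfderiv 𝓘(ℝ, EuclideanSpace ℝ (Fin 2)) 𝓘(ℝ, E) i p v ∈ P (i p) := by
  rw [← hi.tangent]
  exact ⟨v, rfl⟩

theorem velocity_comp_mem (hi : IsIntegralSurface P U i) {γ : ℝ → L} {t : ℝ}
    (hγ : MDifferentiableAt 𝓘(ℝ, ℝ) 𝓘(ℝ, EuclideanSpace ℝ (Fin 2)) γ t) :
    velocity (fun s => i (γ s)) t ∈ P (i (γ t)) := by
  have hcomp : velocity (fun s => i (γ s)) t = _ :=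
    mfderiv_comp_apply t (hi.mdifferentiableAt (γ t)) hγ (1 : ℝ)
  rw [hcomp]
  exact hi.mfderiv_mem _ _

theorem finrank_tangentPlane (hi : IsIntegralSurface P U i) (p : L) :
    Module.finrank ℝ (tangentPlane (E := E) i p) = 2 := by
  rw [tangentPlane, LinearMap.finrank_range_of_inj (hi.immersion p)]
  exact finrank_euclideanSpace_fin

theorem finrank_quotient_tangentPlane [FiniteDimensional ℂ E] (hi : IsIntegralSurface P U i)
    (p : L) : Module.finrank ℝ (TangentSpace 𝓘(ℝ, E) (i p) ⧸ tangentPlane i p) + 2 =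
      2 * Module.finrank ℂ E := by
  have : FiniteDimensional ℝ (TangentSpace 𝓘(ℝ, E) (i p)) := FiniteDimensional.complexToReal E
  have hsum := Submodule.finrank_quotient_add_finrank (tangentPlane (E := E) i p)
  rw [hi.finrank_tangentPlane] at hsum
  exact hsum.trans (finrank_real_of_complex E)

theorem isRiemannianUpTo (hg : IsHermitianMetric g ν) (hi : IsIntegralSurface (leePlane B) U i)
    {c : ℝ} (hc : c ≠ 0) (hBc : ∀ p, g (i p) (B (i p)) (B (i p)) = c) :
    IsRiemannianUpTo g i (Real.sign c) := by
  intro p v hv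
  have hpos := hg.sign_mul_pos_of_mem_leePlane ((hBc p).trans_ne hc) (hi.mfderiv_mem p v) fun h =>
    hv (hi.immersion p (h.trans (map_zero _).symm))
  rwa [hBc p] at hpos

theorem isCompl_normalBundle [FiniteDimensional ℂ E] (hg : IsHermitianMetric g ν)
    (hi : IsIntegralSurface (leePlane B) U i) {p : L} (hB : g (i p) (B (i p)) (B (i p)) ≠ 0) :
    IsCompl (normalBundle g i p) (tangentPlane i p) := by
  rw [normalBundle, hi.tangent]
  exact hg.isCompl_perp_leePlane hB

theorem radical_eq_tangentPlane (hg : IsHermitianMetric g ν)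
    (hi : IsIntegralSurface (leePlane B) U i) {p : L} (hB : g (i p) (B (i p)) (B (i p)) = 0) :
    radical g i p = tangentPlane i p := by
  rw [radical, normalBundle, hi.tangent]
  exact inf_eq_left.2 (hg.leePlane_le_perp hB)

theorem isCompl_of_isTransversalBundle [FiniteDimensional ℂ E] (hg : IsHermitianMetric g ν)
    (hi : IsIntegralSurface (leePlane B) U i) {n : ℕ}
    {tr : Π p : L, Submodule ℝ (TangentSpace 𝓘(ℝ, E) (i p))} (htr : IsTransversalBundle g n i tr)
    {p : L} (hB : g (i p) (B (i p)) (B (i p)) = 0) : IsCompl (tr p) (tangentPlane i p) := by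
  have : FiniteDimensional ℝ (TangentSpace 𝓘(ℝ, E) (i p)) := FiniteDimensional.complexToReal E
  obtain ⟨S, ltr, -, -, h⟩ := htr
  obtain ⟨hS, hS', -, hltr, hnull, htr⟩ := h p
  rw [htr]
  refine isCompl_sup_of_isTotallyNull (hg.nondegenerate_form (i p)) (hg.isRefl_form (i p)) ?_
    hS hS' hltr hnull
  rw [hi.tangent]
  exact hg.leePlane_le_perp hB

theorem isIsotropic [FiniteDimensional ℂ E] (hg : IsHermitianMetric g ν)
    (hi : IsIntegralSurface (leePlane B) U i) (hB : ∀ p, g (i p) (B (i p)) (B (i p)) = 0)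
    (hn : 3 ≤ Module.finrank ℂ E) : IsIsotropic g i := by
  intro p
  have hcodim := hi.finrank_quotient_tangentPlane p
  rw [hi.radical_eq_tangentPlane hg (hB p), hi.finrank_tangentPlane]
  omega

theorem isTotallyLightlike [FiniteDimensional ℂ E] (hg : IsHermitianMetric g ν)
    (hi : IsIntegralSurface (leePlane B) U i) (hB : ∀ p, g (i p) (B (i p)) (B (i p)) = 0)
    (hn : Module.finrank ℂ E = 2) : IsTotallyLightlike g i := by
  intro p
  have hcodim := hi.finrank_quotient_tangentPlane p
  rw [hi.radical_eq_tangentPlane hg (hB p), hi.finrank_tangentPlane]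
  omega

end IsIntegralSurface

namespace IsVaisman

theorem secondFundamentalFormVanishes [FiniteDimensional ℂ E] (hV : IsVaisman g ν lee nabla B)
    (hi : IsIntegralSurface (leePlane B) (Sing B)ᶜ i)
    {tr : Π p : L, Submodule ℝ (TangentSpace 𝓘(ℝ, E) (i p))}
    (htr : ∀ p, IsCompl (tr p) (tangentPlane i p)) : SecondFundamentalFormVanishes nabla i tr := by
  refine fun p => ⟨htr p, fun v Y hY hYP => ?_⟩
  rw [Submodule.projection_apply_eq_zero_iff, hi.tangent]
  simp only [hi.tangent] at hYP
  exact hV.nabla_mem_leePlane (hi.mdifferentiableAt p) (hi.mfderiv_mem p v) (hi.mem p)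
    (IsSmoothAt.isDiffAt hY) hYP

theorem isTotallyGeodesic [FiniteDimensional ℂ E] (hV : IsVaisman g ν lee nabla B)
    (hi : IsIntegralSurface (leePlane B) (Sing B)ᶜ i)
    (hB : ∀ p, g (i p) (B (i p)) (B (i p)) ≠ 0) : IsTotallyGeodesic g nabla i := by
  intro T γ hT hγ hacc t ht
  obtain ⟨a, ha, V, hVs, hVγ, rfl⟩ := hacc t ht
  have hγd (s : ℝ) (hs : s ∈ T) :
      MDifferentiableAt 𝓘(ℝ, ℝ) 𝓘(ℝ, EuclideanSpace ℝ (Fin 2)) γ s :=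
    (hγ.contMDiffAt (hT.mem_nhds hs)).mdifferentiableAt (by simp)
  have hVP : ∀ᶠ s in 𝓝 t, V (i (γ s)) ∈ leePlane B (i (γ s)) := by
    filter_upwards [hVγ, hT.mem_nhds ht] with s hs hsT
    rw [hs]
    exact hi.velocity_comp_mem (hγd s hsT)
  have htangent : nabla V (i (γ t)) (velocity (fun s => i (γ s)) t) ∈ leePlane B (i (γ t)) :=
    hV.nabla_mem_leePlane (j := fun s => i (γ s)) ((hi.mdifferentiableAt (γ t)).comp t (hγd t ht))
      (hi.velocity_comp_mem (hγd t ht)) (hi.mem _) (IsSmoothAt.isDiffAt hVs) hVP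
  rw [normalBundle, hi.tangent] at ha
  exact ⟨V, hVs, hVγ, Submodule.disjoint_def.1
    (hV.isHermitianMetric.disjoint_leePlane_perp (hB (γ t))) _ htangent ha⟩

end IsVaisman

end Surface

end LCK

end

open LCK

theorem theorem4_general {E : Type*} [NormedAddCommGroup E] [NormedSpace ℂ E]
    [FiniteDimensional ℂ E]
    {M : Type*} [TopologicalSpace M] [ChartedSpace E M] [IsManifold 𝓘(ℂ, E) ω M]
    (n : ℕ) (hdim : Module.finrank ℂ E = n) (ν : ℕ)
    (g : Π x : M, TangentSpace 𝓘(ℝ, E) x →L[ℝ] TangentSpace 𝓘(ℝ, E) x →L[ℝ] ℝ)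
    (hg : IsHermitianMetric g ν)
    (lee : Π x : M, TangentSpace 𝓘(ℝ, E) x →L[ℝ] ℝ)
    (hlck : IsLocallyConformalKahler g lee)
    (nabla : (Π x : M, TangentSpace 𝓘(ℝ, E) x) →
      (Π x : M, TangentSpace 𝓘(ℝ, E) x →L[ℝ] TangentSpace 𝓘(ℝ, E) x))
    (hnabla : IsLeviCivitaOn g nabla Set.univ)
    (hlee : IsParallelForm nabla lee)
    (B : Π x : M, TangentSpace 𝓘(ℝ, E) x) (hB : IsLeeField g lee B) :
    IsLocallyConstant (fun x => g x (B x) (B x)) ∧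
    IsOpen (Sing B)ᶜ ∧
    (∀ x ∈ (Sing B)ᶜ, LinearIndependent ℝ ![antiLee B x, B x]) ∧
    IsSmoothDistributionOn (leePlane B) 2 (Sing B)ᶜ ∧
    IsInvolutiveOn (leePlane B) (Sing B)ᶜ ∧
    IsTangentToFoliationOn (leePlane B) 2 (Sing B)ᶜ ∧
    ((∀ x, g x (B x) (B x) ≠ 0) → Sing B = ∅) ∧
    ∀ (L : Type*) [TopologicalSpace L] [ChartedSpace (EuclideanSpace ℝ (Fin 2)) L] (i : L → M),
      IsIntegralSurface (leePlane B) (Sing B)ᶜ i →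
      ∀ c : ℝ, (∀ p, g (i p) (B (i p)) (B (i p)) = c) →
        (c ≠ 0 →
          IsRiemannianUpTo g i (Real.sign c) ∧
          SecondFundamentalFormVanishes nabla i (normalBundle g i) ∧
          IsTotallyGeodesic g nabla i) ∧
        (c = 0 →
          (3 ≤ n → IsIsotropic g i) ∧
          (n = 2 → IsTotallyLightlike g i) ∧
          ∀ tr : Π p : L, Submodule ℝ (TangentSpace 𝓘(ℝ, E) (i p)),
            IsTransversalBundle g n i tr → SecondFundamentalFormVanishes nabla i tr) := by
  have hV : IsVaisman g ν lee nabla B := ⟨hg, hlck, hnabla, hlee, hB⟩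
  refine ⟨hV.isLocallyConstant_leeField_sq, isOpen_compl_sing hV.isSmoothAt_leeField,
    fun x hx => linearIndependent_antiLee hx,
    isSmoothDistributionOn_leePlane hV.isSmoothAt_leeField,
    hV.isInvolutiveOn_leePlane, hV.isTangentToFoliationOn_leePlane, sing_eq_empty,
    fun L _ _ i hi c hc => ⟨fun hc0 => ?nonnull, fun hc0 => ?null⟩⟩
  case nonnull =>
    have hne (p : L) : g (i p) (B (i p)) (B (i p)) ≠ 0 := (hc p).trans_ne hc0
    exact ⟨hi.isRiemannianUpTo hg hc0 hc,
      hV.secondFundamentalFormVanishes hi fun p => hi.isCompl_normalBundle hg (hne p),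
      hV.isTotallyGeodesic hi hne⟩
  case null =>
    have hnull (p : L) : g (i p) (B (i p)) (B (i p)) = 0 := (hc p).trans hc0
    exact ⟨fun hn => hi.isIsotropic hg hnull (hn.trans_eq hdim.symm),
      fun hn => hi.isTotallyLightlike hg hnull (hdim.trans hn),
      fun tr htr => hV.secondFundamentalFormVanishes hi fun p =>
        hi.isCompl_of_isTransversalBundle hg htr (hnull p)⟩

theorem theorem4 {E : Type*} [NormedAddCommGroup E] [NormedSpace ℂ E]
    [FiniteDimensional ℂ E]
    {M : Type*} [TopologicalSpace M] [T2Space M] [ChartedSpace E M] [IsManifold 𝓘(ℂ, E) ω M]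
    (n : ℕ) (hdim : Module.finrank ℂ E = n) (hn : 1 < n)
    (ν : ℕ) (hν : 0 < ν) (hν' : ν < 2 * n)
    (g : Π x : M, TangentSpace 𝓘(ℝ, E) x →L[ℝ] TangentSpace 𝓘(ℝ, E) x →L[ℝ] ℝ)
    (hg : IsHermitianMetric g ν)
    (lee : Π x : M, TangentSpace 𝓘(ℝ, E) x →L[ℝ] ℝ)
    (hlck : IsLocallyConformalKahler g lee)
    (nabla : (Π x : M, TangentSpace 𝓘(ℝ, E) x) →
      (Π x : M, TangentSpace 𝓘(ℝ, E) x →L[ℝ] TangentSpace 𝓘(ℝ, E) x))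
    (hnabla : IsLeviCivitaOn g nabla Set.univ)
    (hlee : IsParallelForm nabla lee)
    (B : Π x : M, TangentSpace 𝓘(ℝ, E) x) (hB : IsLeeField g lee B) :
    IsLocallyConstant (fun x => g x (B x) (B x)) ∧
    ∀ c : ℝ, (∀ x, g x (B x) (B x) = c) →
      IsOpen (Sing B)ᶜ ∧
      (∀ x ∈ (Sing B)ᶜ, LinearIndependent ℝ ![antiLee B x, B x]) ∧
      IsSmoothDistributionOn (leePlane B) 2 (Sing B)ᶜ ∧
      IsInvolutiveOn (leePlane B) (Sing B)ᶜ ∧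
      IsTangentToFoliationOn (leePlane B) 2 (Sing B)ᶜ ∧
      (c ≠ 0 → Sing B = ∅) ∧
      ∀ (L : Type*) [TopologicalSpace L] [ChartedSpace (EuclideanSpace ℝ (Fin 2)) L]
        [IsManifold 𝓘(ℝ, EuclideanSpace ℝ (Fin 2)) ∞ L] (i : L → M),
        IsIntegralSurface (leePlane B) (Sing B)ᶜ i →
        (c ≠ 0 →
          IsRiemannianUpTo g i (Real.sign c) ∧
          SecondFundamentalFormVanishes nabla i (normalBundle g i) ∧
          IsTotallyGeodesic g nabla i) ∧
        (c = 0 →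
          (3 ≤ n → IsIsotropic g i) ∧
          (n = 2 → IsTotallyLightlike g i) ∧
          (3 ≤ n → ∀ tr : Π p : L, Submodule ℝ (TangentSpace 𝓘(ℝ, E) (i p)),
            IsTransversalBundle g n i tr → SecondFundamentalFormVanishes nabla i tr)) := by
  obtain ⟨hconst, hopen, hindep, hsmooth, hinv, hfol, hsing, hsurface⟩ :=
    theorem4_general n hdim ν g hg lee hlck nabla hnabla hlee B hB
  exact ⟨hconst, fun c hc => ⟨hopen, hindep, hsmooth, hinv, hfol,
    fun hc0 => hsing fun x => (hc x).trans_ne hc0, fun L _ _ _ i hi =>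
      (hsurface L i hi c fun p => hc (i p)).imp_right fun h hc0 =>
        ⟨(h hc0).1, (h hc0).2.1, fun _ => (h hc0).2.2⟩⟩⟩
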